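/- Conventions. Let $d,D\ge 1$. $B_r(x)$ is the open Euclidean ball, and $K^{(\eta)}$ is the open $\eta$-neighbourhood of $K$. A \emph{gauge function} is a strictly increasing continuous function $q:[0,R)\to\mathbb R_+$ with $q(0)=0$, where $0<R\le\infty$. For a gauge function $q$ put $g_q(\tau)=\tau^D/(q^{-1}(\tau))^d$ (defined for small $\tau>0$), and for $A\subset\mathbb R^D$ let $$\mathcal H_{g_q}(A)=\lim_{\varepsilon\downarrow0}\ \inf\Big\{\sum_i g_q(2r_i):\ A\subset\bigcup_i B_{r_i}(x_i),\ 0<r_i\le\varepsilon\Big\},$$ the infimum being over at most countable families of balls. Let $K\subset\mathbb R^d$ be a compact set of positive Lebesgue measure. Let $q$ be a gauge function that is differentiable on $(0,R)$, with derivative $\dot q$, such that: (a) there are Borel functions $\varphi,\psi$ and $c_0>0$ such that, for all $r,\tau\in(0,c_0]$, $$q(r\tau)\le\varphi(\tau)q(r),\qquad \dot q(r\tau)\le\tfrac1r\,\psi(\tau)\,q(r\tau),$$ and, for some constant $\tilde C>0$ and all $p\ge1$, the function $\tau\mapsto\log^p\big(1+\tilde C\tau^{-2d}\big)\varphi(\tau)\psi(\tau)$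 is integrable on $(0,1]$; (b) $g_q$ is strictly increasing on some interval $(0,\rho_0)$, $\rho_0>0$. Let $\eta,\sigma,C_0,\varepsilon_0>0$. Then there is a finite constant $C$, depending only on $d,D,K,q,\eta,\sigma,C_0,\varepsilon_0$ (and the data in (a), (b)), such that the following holds. Let $M=\{M(x)=(M_1(x),\dots,M_D(x)),\ x\in\mathbb R^d\}$ be a (not necessarily centred) Gaussian process with almost surely continuous sample paths, whose components $M_1,\dots,M_D$ are independent and identically distributed processes, such that $\inf_{x\in K^{(\eta)}}\mathrm{Var}(M_i(x))\ge\sigma^2$, and such that for all $\varepsilon\in(0,\varepsilon_0)$ and all $x\in K^{(\eta)}$, $$E\left(\int_{B_\varepsilon(x)}dy\int_{B_\varepsilon(x)}d\bar y\ \exp\left(\frac{|M(y)-M(\bar y)|}{q(|y-\bar y|)}\right)\right)\le C_0\,\varepsilon^{2d}.$$ Then for every Borel set $A\subset\mathbb R^D$, $$P\big(M(K)\cap A\neq\emptyset\big)\le C\,\mathcal H_{g_q}(A).$$ -/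

import Mathlib

open MeasureTheory ProbabilityTheory Set
open scoped ENNReal NNReal

universe u

noncomputable section

/-- The interval `[0, R)` of real numbers, with `R ≤ ∞`. For `R = ∞` it is the half-line `[0, ∞)`. -/
def gaugeDomain (R : ℝ≥0∞) : Set ℝ := {t : ℝ | 0 ≤ t ∧ ENNReal.ofReal t < R}

/-- `q` is a gauge function on `[0, R)`: strictly increasing, continuous, and `q 0 = 0`
(so that `q` is nonnegative on `[0, R)`). The values of `q` outside `[0, R)` play no role. -/
structure IsGauge (R : ℝ≥0∞) (q : ℝ → ℝ) : Prop where
  pos : 0 < R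
  zero : q 0 = 0
  strictMonoOn : StrictMonoOn q (gaugeDomain R)
  continuousOn : ContinuousOn q (gaugeDomain R)

/-- A gauge function that is differentiable at every `t ∈ (0, R)`. (Differentiability at the
end point `0` is not asked for: it fails for `t ↦ t ^ ν` with `0 < ν < 1`.) -/
structure IsDifferentiableGauge (R : ℝ≥0∞) (q : ℝ → ℝ) : Prop extends IsGauge R q where
  differentiableAt : ∀ t ∈ gaugeDomain R, 0 < t → DifferentiableAt ℝ q t

/-- The scaling and integrability conditions on `q`: for all sufficiently small `r, τ > 0`
one has `q (r τ) ≤ φ τ * q r` and `q' (r τ) ≤ (1 / r) * ψ τ * q (r τ)`, where `φ, ψ` are Borel and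
`∫₀¹ log^p (1 + C / τ^(2d)) φ τ ψ τ dτ` is finite for every `p ≥ 1`. -/
def ScalingCondition (d : ℕ) (R : ℝ≥0∞) (q : ℝ → ℝ) : Prop :=
  ∃ φ ψ : ℝ → ℝ, Measurable φ ∧ Measurable ψ ∧
    (∃ c₀ ∈ gaugeDomain R, 0 < c₀ ∧ c₀ ≤ 1 ∧
      ∀ r ∈ Ioc 0 c₀, ∀ τ ∈ Ioc 0 c₀,
        q (r * τ) ≤ φ τ * q r ∧ deriv q (r * τ) ≤ 1 / r * ψ τ * q (r * τ)) ∧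
    ∃ Ct : ℝ, 0 < Ct ∧ ∀ p : ℝ, 1 ≤ p →
      IntegrableOn (fun τ : ℝ => Real.log (1 + Ct / τ ^ (2 * d)) ^ p * (φ τ * ψ τ)) (Ioc 0 1)

/-- The inverse function of `q : [0, R) → ℝ`. It is meaningful on the range `q '' [0, R)`, which
contains an interval `[0, δ)` when `q` is a gauge function. -/
def gaugeInv (R : ℝ≥0∞) (q : ℝ → ℝ) : ℝ → ℝ := Function.invFunOn q (gaugeDomain R)

/-- `g_q(τ) = τ^D / (q⁻¹(τ))^d`. -/
def gaugeRatio (d D : ℕ) (R : ℝ≥0∞) (q : ℝ → ℝ) (τ : ℝ) : ℝ := τ ^ D / gaugeInv R q τ ^ d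

/-- The infimum of `∑ g (2 r_i)` over all countable (finite or infinite) coverings of `A` by open
Euclidean balls of radii `0 < r_i ≤ ε`. -/
def gHausdorffPre {D : ℕ} (g : ℝ → ℝ) (ε : ℝ) (A : Set (EuclideanSpace ℝ (Fin D))) : ℝ≥0∞ :=
  ⨅ (s : Set ℕ) (x : ℕ → EuclideanSpace ℝ (Fin D)) (r : ℕ → ℝ)
    (_ : ∀ i ∈ s, 0 < r i ∧ r i ≤ ε) (_ : A ⊆ ⋃ i ∈ s, Metric.ball (x i) (r i)),
    ∑' i : s, ENNReal.ofReal (g (2 * r i))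

/-- The `g`-Hausdorff measure of `A`: the limit as `ε ↓ 0` of `gHausdorffPre g ε A`, which is
the supremum over `ε > 0`, by monotonicity in `ε`. -/
def gHausdorff {D : ℕ} (g : ℝ → ℝ) (A : Set (EuclideanSpace ℝ (Fin D))) : ℝ≥0∞ :=
  ⨆ (ε : ℝ) (_ : 0 < ε), gHausdorffPre g ε A

/-- The coordinate processes `M_1, …, M_D` of a random field `M` are independent and identically
distributed, as random elements of the space of functions of `x` with its product
`σ`-algebra (that is, in the sense of finite-dimensional distributions). -/
structure HasIIDComponents {d D : ℕ} {Ω : Type u} [MeasurableSpace Ω]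
    (M : EuclideanSpace ℝ (Fin d) → Ω → EuclideanSpace ℝ (Fin D)) (P : Measure Ω) : Prop where
  indep : iIndepFun (fun (i : Fin D) (ω : Ω) (x : EuclideanSpace ℝ (Fin d)) => M x ω i) P
  identDistrib : ∀ i j : Fin D,
    IdentDistrib (fun (ω : Ω) (x : EuclideanSpace ℝ (Fin d)) => M x ω i)
      (fun (ω : Ω) (x : EuclideanSpace ℝ (Fin d)) => M x ω j) P P

/-- The exponential-moment condition at the point `x` and scale `ε`, with constant `C₀`:
`E ∫_{B_ε(x)} dy ∫_{B_ε(x)} dy' exp (|M(y) - M(y')| / q(|y - y'|)) ≤ C₀ ε^(2d)`.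
(The diagonal `y = y'` has measure zero when `0 < d`.) -/
def ExpMomentBound {d D : ℕ} {Ω : Type u} [MeasurableSpace Ω]
    (M : EuclideanSpace ℝ (Fin d) → Ω → EuclideanSpace ℝ (Fin D)) (P : Measure Ω)
    (q : ℝ → ℝ) (C₀ ε : ℝ) (x : EuclideanSpace ℝ (Fin d)) : Prop :=
  ∫⁻ ω, (∫⁻ y in Metric.ball x ε, (∫⁻ y' in Metric.ball x ε,
    ENNReal.ofReal (Real.exp (‖M y ω - M y' ω‖ / q ‖y - y'‖)) ∂volume) ∂volume) ∂P
      ≤ ENNReal.ofReal (C₀ * ε ^ (2 * d))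

end

/-! ### Averages under an exponential moment bound. -/

section Averages

variable {α : Type*} [MeasurableSpace α]

/-! By countable subadditivity over a covering of `A`, it suffices that `M(K)` hits a ball of small
radius `τ` with probability at most `C * τ ^ D / r ^ d`, where `q r = τ`
(`exists_measure_hit_ball_le`). Cover `K` by `O(r⁻ᵈ)` balls of radius proportional to `r`; it
remains to see that `M` maps such a ball `B` into contact with a ball of radius `τ` with probability
`O(τ ^ D)`. By independence of the components this reduces to a bound `O(τ)` for each real
component.

Two facts give that bound. The oscillation of a component over `B` is `O(q r) = O(τ)` in `L²`: a
Garsia–Rodemich–Rumsey chaining argument bounds it pathwise by `q r * (c₁ + c₂ * log (1 + Z))`, with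
`Z` the normalised exponential double integral, and the square of this is at most linear in `Z`
(`exists_lintegral_oscillation_sq_le`). Second, a Gaussian process with variance at least `σ²` at
`x` and `L²` oscillation `e` around `x` comes within `ε` of a level with probability `O((e + ε) /
σ)`, whatever its mean (`measure_exists_abs_sub_lt_le`); this follows by regressing the process on
its value at `x`. -/

theorem enorm_integral_sub_integral_le {μ ν : Measure α} [IsProbabilityMeasure μ]
    [IsProbabilityMeasure ν] {f : α → ℝ} (hμ : Integrable f μ) (hν : Integrable f ν) :
    ‖∫ u, f u ∂μ - ∫ v, f v ∂ν‖ₑ ≤ ∫⁻ u, ∫⁻ v, ‖f u - f v‖ₑ ∂ν ∂μ := by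
  have h1 : ∫ u, f u ∂μ - ∫ v, f v ∂ν = ∫ u, (∫ v, (f u - f v) ∂ν) ∂μ := by
    have : ∀ u, ∫ v, (f u - f v) ∂ν = f u - ∫ v, f v ∂ν := fun u => by
      rw [integral_sub (integrable_const _) hν]; simp
    simp_rw [this]
    rw [integral_sub hμ (integrable_const _)]; simp
  rw [h1]
  refine (enorm_integral_le_lintegral_enorm _).trans (lintegral_mono fun u => ?_)
  exact enorm_integral_le_lintegral_enorm _

/-- Jensen's inequality for `log`, in the form of its tangent line: `s ≤ l + exp (-l) * exp s`,
whose average is at most `l + 1`. This form needs no measurability of `s`. -/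
theorem abs_integral_sub_integral_le_of_exp_bound {μ ν : Measure α} [IsProbabilityMeasure μ]
    [IsProbabilityMeasure ν] {f : α → ℝ} (hμ : Integrable f μ) (hν : Integrable f ν)
    {s : α → α → ℝ} {w l : ℝ} (hw : 0 ≤ w) (hl : 0 ≤ l)
    (hs : ∀ᵐ u ∂μ, ∀ᵐ v ∂ν, |f u - f v| ≤ w * s u v)
    (hZ : ∫⁻ u, ∫⁻ v, ENNReal.ofReal (Real.exp (s u v)) ∂ν ∂μ ≤ ENNReal.ofReal (Real.exp l)) :
    |∫ u, f u ∂μ - ∫ v, f v ∂ν| ≤ w * (l + 1) := by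
  have key : ∀ u v, |f u - f v| ≤ w * s u v →
      ‖f u - f v‖ₑ ≤ ENNReal.ofReal (w * l) +
        ENNReal.ofReal (w * Real.exp (-l)) * ENNReal.ofReal (Real.exp (s u v)) := by
    intro u v h
    rw [← ENNReal.ofReal_mul (by positivity), ← ENNReal.ofReal_add (by positivity) (by positivity),
      Real.enorm_eq_ofReal_abs]
    refine ENNReal.ofReal_le_ofReal (h.trans ?_)
    have h2 : s u v - l ≤ Real.exp (s u v - l) := by
      linarith [Real.add_one_le_exp (s u v - l)]
    have h3 : Real.exp (s u v - l) = Real.exp (-l) * Real.exp (s u v) := by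
      rw [← Real.exp_add]; ring_nf
    rw [h3] at h2
    nlinarith
  have h1 : ‖∫ u, f u ∂μ - ∫ v, f v ∂ν‖ₑ ≤ ENNReal.ofReal (w * (l + 1)) := by
    calc ‖∫ u, f u ∂μ - ∫ v, f v ∂ν‖ₑ
        ≤ ∫⁻ u, ∫⁻ v, ‖f u - f v‖ₑ ∂ν ∂μ := enorm_integral_sub_integral_le hμ hν
      _ ≤ ∫⁻ u, ∫⁻ v, (ENNReal.ofReal (w * l) + ENNReal.ofReal (w * Real.exp (-l)) *
            ENNReal.ofReal (Real.exp (s u v))) ∂ν ∂μ := by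
          refine lintegral_mono_ae ?_
          filter_upwards [hs] with u hu
          refine lintegral_mono_ae ?_
          filter_upwards [hu] with v hv using key u v hv
      _ = ENNReal.ofReal (w * l) + ENNReal.ofReal (w * Real.exp (-l)) *
            ∫⁻ u, ∫⁻ v, ENNReal.ofReal (Real.exp (s u v)) ∂ν ∂μ := by
          simp_rw [lintegral_add_left measurable_const, lintegral_const_mul' _ _ ENNReal.ofReal_ne_top]
          simp
      _ ≤ ENNReal.ofReal (w * l) + ENNReal.ofReal (w * Real.exp (-l)) *
            ENNReal.ofReal (Real.exp l) := by gcongr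
      _ = ENNReal.ofReal (w * (l + 1)) := by
          rw [← ENNReal.ofReal_mul (by positivity),
            ← ENNReal.ofReal_add (by positivity) (by positivity), mul_assoc, ← Real.exp_add]
          simp [mul_add]
  rw [Real.enorm_eq_ofReal_abs] at h1
  exact (ENNReal.ofReal_le_ofReal_iff (by positivity)).1 h1

end Averages

/-! ### Chaining along shrinking balls. -/

section Chaining

variable {d : ℕ}

theorem volume_ball_smul_radius (x c : EuclideanSpace ℝ (Fin d)) {a t : ℝ} (ht : 0 < t) :
    volume (Metric.ball c (t * a)) = ENNReal.ofReal (t ^ d) * volume (Metric.ball x a) := by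
  rw [Measure.addHaar_ball_mul_of_pos _ _ ht, Measure.addHaar_ball_center volume x]
  simp

/-- These balls are the images of `ball x a` under homotheties centred at `y`; they are nested
because `y` lies in the ball. -/
theorem ball_homothety_subset {E : Type*} [NormedAddCommGroup E] [NormedSpace ℝ E]
    {x y : E} {a s t : ℝ} (ha : y ∈ Metric.ball x a) (hst : s ≤ t) :
    Metric.ball (y + s • (x - y)) (s * a) ⊆ Metric.ball (y + t • (x - y)) (t * a) := by
  intro u hu
  rw [mem_ball_iff_norm] at *
  have h1 : u - (y + t • (x - y)) = (u - (y + s • (x - y))) + (t - s) • (y - x) := by module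
  have h2 : ‖(t - s) • (y - x)‖ ≤ (t - s) * a := by
    rw [norm_smul, Real.norm_of_nonneg (by linarith)]
    gcongr
  rw [h1]
  refine (norm_add_le _ _).trans_lt ?_
  nlinarith

/-- The averages of `f` over the homothetic balls of ratio `t n` start at the average over `ball x
a` and tend to `f y`. All these balls lie in `ball x a`, so consecutive averages are compared
through the same double integral, and the normalisation costs the factor `(t n * t (n + 1)) ^ (-d)`
recorded in `hlZ`. -/
theorem abs_sub_average_le_of_chain {f : EuclideanSpace ℝ (Fin d) → ℝ} (hf : Continuous f)
    {x y : EuclideanSpace ℝ (Fin d)} {a : ℝ} (hy : y ∈ Metric.ball x a)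
    {t : ℕ → ℝ} (ht0 : t 0 = 1) (htpos : ∀ n, 0 < t n) (hanti : Antitone t)
    (htlim : Filter.Tendsto t Filter.atTop (nhds 0))
    {s : EuclideanSpace ℝ (Fin d) → EuclideanSpace ℝ (Fin d) → ℝ} {w l : ℕ → ℝ}
    (hw : ∀ n, 0 ≤ w n) (hl : ∀ n, 0 ≤ l n)
    (hs : ∀ n, ∀ u ∈ Metric.ball x a, ∀ v ∈ Metric.ball x a, dist u v < 2 * a * t n →
      |f u - f v| ≤ w n * s u v)
    {Z : ℝ} (hZ0 : 0 ≤ Z)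
    (hZ : ∫⁻ u in Metric.ball x a, ∫⁻ v in Metric.ball x a, ENNReal.ofReal (Real.exp (s u v))
      ≤ ENNReal.ofReal Z * volume (Metric.ball x a) ^ 2)
    (hlZ : ∀ n, Z / (t n ^ d * t (n + 1) ^ d) ≤ Real.exp (l n))
    {S : ℝ} (hS : ∀ N, ∑ n ∈ Finset.range N, w n * (l n + 1) ≤ S) :
    |f y - ⨍ u in Metric.ball x a, f u| ≤ S := by
  have ha : 0 < a := (dist_nonneg).trans_lt (Metric.mem_ball.1 hy)
  set A : ℕ → Set (EuclideanSpace ℝ (Fin d)) :=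
    fun n => Metric.ball (y + t n • (x - y)) (t n * a) with hA
  have hA0 : A 0 = Metric.ball x a := by simp [hA, ht0]
  have hAanti : Antitone A := fun m n hmn => ball_homothety_subset hy (hanti hmn)
  have hAsub : ∀ n, A n ⊆ Metric.ball x a := fun n => hA0 ▸ hAanti (Nat.zero_le n)
  have hvol : ∀ n, volume (A n) = ENNReal.ofReal (t n ^ d) * volume (Metric.ball x a) :=
    fun n => volume_ball_smul_radius _ _ (htpos n)
  have hB0 : volume (Metric.ball x a) ≠ 0 := (Metric.measure_ball_pos _ _ ha).ne'
  have hBt : volume (Metric.ball x a) ≠ ∞ := measure_ball_lt_top.ne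
  have hAn0 : ∀ n, volume (A n) ≠ 0 := fun n =>
    (Metric.measure_ball_pos _ _ (mul_pos (htpos n) ha)).ne'
  have hAnt : ∀ n, volume (A n) ≠ ∞ := fun n => measure_ball_lt_top.ne
  set μ : ℕ → Measure (EuclideanSpace ℝ (Fin d)) :=
    fun n => (volume (A n))⁻¹ • volume.restrict (A n) with hμ
  have hprob : ∀ n, IsProbabilityMeasure (μ n) := fun n => ⟨by
    simp [hμ, ENNReal.inv_mul_cancel (hAn0 n) (hAnt n)]⟩
  have havg : ∀ n, ⨍ u in A n, f u = ∫ u, f u ∂(μ n) := fun n => by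
    simp [average, hμ]
  have hint : ∀ n, Integrable f (μ n) := fun n => by
    refine Integrable.smul_measure ?_ (ENNReal.inv_ne_top.2 (hAn0 n))
    exact (hf.continuousOn.integrableOn_compact (isCompact_closedBall _ _)).mono_set
      Metric.ball_subset_closedBall
  have hae : ∀ n, ∀ᵐ u ∂(μ n), u ∈ A n := fun n =>
    Measure.ae_smul_measure (ae_restrict_mem Metric.isOpen_ball.measurableSet) _
  have hstep : ∀ n, |∫ u, f u ∂(μ n) - ∫ u, f u ∂(μ (n + 1))| ≤ w n * (l n + 1) := by
    intro n
    refine abs_integral_sub_integral_le_of_exp_bound (hint n) (hint (n + 1)) (hw n) (hl n)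
      (s := s) ?_ ?_
    · filter_upwards [hae n] with u hu
      filter_upwards [hae (n + 1)] with v hv
      refine hs n u (hAsub n hu) v (hAsub _ hv) ?_
      have hv' := hAanti (Nat.le_succ n) hv
      have := dist_triangle_right u v (y + t n • (x - y))
      have h1 := Metric.mem_ball.1 hu
      have h2 := Metric.mem_ball.1 hv'
      nlinarith
    · have h1 : ∫⁻ u, ∫⁻ v, ENNReal.ofReal (Real.exp (s u v)) ∂(μ (n + 1)) ∂(μ n)
          ≤ (volume (A n))⁻¹ * ((volume (A (n + 1)))⁻¹ *
            (ENNReal.ofReal Z * volume (Metric.ball x a) ^ 2)) := by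
        simp only [hμ, lintegral_smul_measure, smul_eq_mul]
        rw [lintegral_const_mul' _ _ (ENNReal.inv_ne_top.2 (hAn0 _))]
        gcongr
        refine le_trans ?_ hZ
        refine (lintegral_mono_set (hAsub n)).trans (lintegral_mono fun u => ?_)
        exact lintegral_mono_set (hAsub _)
      refine h1.trans ?_
      have h2 : (volume (A n))⁻¹ * ((volume (A (n + 1)))⁻¹ *
            (ENNReal.ofReal Z * volume (Metric.ball x a) ^ 2)) =
            ENNReal.ofReal (Z / (t n ^ d * t (n + 1) ^ d)) := by
        have e1 := pow_pos (htpos n) d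
        have e2 := pow_pos (htpos (n+1)) d
        obtain ⟨b, hb⟩ : ∃ b : ℝ, ENNReal.ofReal b = volume (Metric.ball x a) :=
          ⟨_, ENNReal.ofReal_toReal hBt⟩
        have hb0 : 0 < b := by
          rw [← ENNReal.ofReal_pos, hb]; exact pos_iff_ne_zero.2 hB0
        rw [hvol, hvol, ← hb, ← ENNReal.ofReal_mul e1.le, ← ENNReal.ofReal_mul e2.le,
          ← ENNReal.ofReal_inv_of_pos (by positivity), ← ENNReal.ofReal_inv_of_pos (by positivity),
          ← ENNReal.ofReal_pow hb0.le, ← ENNReal.ofReal_mul hZ0, ← ENNReal.ofReal_mul (by positivity),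
          ← ENNReal.ofReal_mul (by positivity)]
        congr 1
        field_simp
      rw [h2]
      exact ENNReal.ofReal_le_ofReal (hlZ n)
  have hsum : ∀ N, |∫ u, f u ∂(μ N) - ∫ u, f u ∂(μ 0)| ≤ S := by
    intro N
    refine le_trans ?_ (hS N)
    induction N with
    | zero => simp
    | succ n ih =>
      rw [Finset.sum_range_succ]
      have h1 := abs_sub_le (∫ u, f u ∂(μ (n + 1))) (∫ u, f u ∂(μ n)) (∫ u, f u ∂(μ 0))
      have h2 := hstep n
      rw [abs_sub_comm] at h2
      linarith
  have hlim : Filter.Tendsto (fun n => ∫ u, f u ∂(μ n)) Filter.atTop (nhds (f y)) := by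
    rw [Metric.tendsto_nhds]
    intro ε hε
    obtain ⟨δ, hδ, hfδ⟩ := Metric.continuousAt_iff.1 hf.continuousAt (ε / 2) (half_pos hε)
    have h2 : Filter.Tendsto (fun n => 2 * a * t n) Filter.atTop (nhds 0) := by
      simpa using htlim.const_mul (2 * a)
    filter_upwards [h2.eventually (gt_mem_nhds hδ)] with n hn
    have h3 : ∀ᵐ u ∂(μ n), ‖f u - f y‖ ≤ ε / 2 := by
      filter_upwards [hae n] with u hu
      have h4 : dist u y < δ := by
        have h5 := dist_triangle u (y + t n • (x - y)) y
        have h6 : dist (y + t n • (x - y)) y ≤ t n * a := by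
          rw [dist_eq_norm, add_sub_cancel_left, norm_smul, Real.norm_of_nonneg (htpos n).le]
          have := mem_ball_iff_norm'.1 hy
          gcongr; exact (htpos n).le
        have h7 := Metric.mem_ball.1 hu
        nlinarith
      exact (hfδ h4).le
    have h8 := norm_integral_le_of_norm_le_const h3
    rw [integral_sub (hint n) (integrable_const _)] at h8
    simp only [integral_const, probReal_univ, smul_eq_mul, one_mul, mul_one] at h8
    rw [dist_eq_norm]
    linarith
  rw [← hA0, havg]
  exact le_of_tendsto ((hlim.sub_const _).abs) (Filter.Eventually.of_forall hsum)

end Chaining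

/-! ### Gauge functions and the pathwise modulus of continuity. -/

section Gauge

variable {R : ℝ≥0∞} {q : ℝ → ℝ}

theorem gaugeDomain_mem_of_le {s t : ℝ} (ht : t ∈ gaugeDomain R) (hs : 0 ≤ s) (hst : s ≤ t) :
    s ∈ gaugeDomain R :=
  ⟨hs, (ENNReal.ofReal_le_ofReal hst).trans_lt ht.2⟩

theorem IsGauge.zero_mem (hq : IsGauge R q) : (0 : ℝ) ∈ gaugeDomain R :=
  ⟨le_rfl, by simpa using hq.pos⟩

theorem IsGauge.apply_pos (hq : IsGauge R q) {t : ℝ} (ht : t ∈ gaugeDomain R) (h0 : 0 < t) :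
    0 < q t := by
  simpa [hq.zero] using hq.strictMonoOn hq.zero_mem ht h0

theorem IsGauge.apply_nonneg (hq : IsGauge R q) {t : ℝ} (ht : t ∈ gaugeDomain R) : 0 ≤ q t := by
  simpa [hq.zero] using hq.strictMonoOn.monotoneOn hq.zero_mem ht ht.1

theorem IsGauge.gaugeInv_spec (hq : IsGauge R q) {b y : ℝ} (hb : b ∈ gaugeDomain R)
    (hy : y ∈ Icc 0 (q b)) :
    gaugeInv R q y ∈ Icc 0 b ∧ q (gaugeInv R q y) = y := by
  have hsub : Icc 0 b ⊆ gaugeDomain R := fun t ht => gaugeDomain_mem_of_le hb ht.1 ht.2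
  have hmem : y ∈ q '' gaugeDomain R := by
    have := intermediate_value_Icc hb.1 (hq.continuousOn.mono hsub)
    rw [hq.zero] at this
    exact image_mono hsub (this hy)
  have h1 : gaugeInv R q y ∈ gaugeDomain R := Function.invFunOn_mem hmem
  have h2 : q (gaugeInv R q y) = y := Function.invFunOn_eq hmem
  refine ⟨⟨h1.1, ?_⟩, h2⟩
  rw [← hq.strictMonoOn.le_iff_le h1 hb, h2]
  exact hy.2

theorem IsDifferentiableGauge.deriv_nonneg (hq : IsDifferentiableGauge R q) {t : ℝ}
    (ht : t ∈ gaugeDomain R) (h0 : 0 < t) : 0 ≤ deriv q t := by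
  have hnhds : gaugeDomain R ∈ nhds t := by
    have h1 : IsOpen {u : ℝ | ENNReal.ofReal u < R} :=
      isOpen_lt ENNReal.continuous_ofReal continuous_const
    filter_upwards [h1.mem_nhds ht.2, lt_mem_nhds h0] with u hu hu0 using ⟨hu0.le, hu⟩
  rw [← derivWithin_of_mem_nhds hnhds]
  exact hq.strictMonoOn.monotoneOn.derivWithin_nonneg

/-- The derivative of `τ ↦ q (r τ)` is at most `q r * (φ τ * ψ τ)`, and the logarithm decreases in
`τ`, so its value at `β` may be moved inside the integral. Thus increments of `q` weighted by
logarithms sum to a single convergent integral. -/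
theorem gauge_increment_mul_le {d : ℕ} {c₀ Ct k r : ℝ} {φ ψ : ℝ → ℝ} (hq : IsDifferentiableGauge R q)
    (hc : c₀ ∈ gaugeDomain R) (hc1 : c₀ ≤ 1)
    (hsc : ∀ r ∈ Ioc 0 c₀, ∀ τ ∈ Ioc 0 c₀,
        q (r * τ) ≤ φ τ * q r ∧ deriv q (r * τ) ≤ 1 / r * ψ τ * q (r * τ))
    (hCt : 0 < Ct) (hk : 0 ≤ k)
    (hint : IntegrableOn (fun τ : ℝ => (Real.log (1 + Ct / τ ^ (2 * d)) + k) * (φ τ * ψ τ))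
      (Ioc 0 c₀)) (hr : r ∈ Ioc 0 c₀) {α β : ℝ} (hα : 0 < α) (hαβ : α ≤ β) (hβ : β ≤ c₀) :
    (q (r * β) - q (r * α)) * (Real.log (1 + Ct / β ^ (2 * d)) + k) ≤
      q r * ∫ τ in α..β, (Real.log (1 + Ct / τ ^ (2 * d)) + k) * (φ τ * ψ τ) := by
  have hdom : ∀ τ ∈ Icc α β, r * τ ∈ gaugeDomain R := fun τ hτ =>
    gaugeDomain_mem_of_le hc (mul_nonneg hr.1.le (hα.le.trans hτ.1))
      ((mul_le_of_le_one_left (hα.le.trans hτ.1) (hr.2.trans hc1)).trans (hτ.2.trans hβ))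
  have hβ0 : 0 < β := hα.trans_le hαβ
  set L : ℝ := Real.log (1 + Ct / β ^ (2 * d)) + k with hL
  have hL0 : 0 ≤ L := add_nonneg (Real.log_nonneg (by
    have : 0 ≤ Ct / β ^ (2 * d) := by positivity
    linarith)) hk
  have hrd : r ∈ gaugeDomain R := gaugeDomain_mem_of_le hc hr.1.le hr.2
  have hqr : 0 < q r := hq.apply_pos hrd hr.1
  have hderiv : ∀ τ ∈ Ioo α β, HasDerivAt (fun τ => q (r * τ) * L) (deriv q (r * τ) * r * L) τ := by
    intro τ hτ
    have h1 := (hq.differentiableAt _ (hdom τ (Ioo_subset_Icc_self hτ))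
      (mul_pos hr.1 (hα.trans hτ.1))).hasDerivAt
    have h2 : HasDerivAt (fun τ => r * τ) r τ := by simpa using (hasDerivAt_id τ).const_mul r
    exact (h1.comp τ h2).mul_const L
  have key := intervalIntegral.sub_le_integral_of_hasDeriv_right_of_le (g := fun τ => q (r * τ) * L)
    (g' := fun τ => deriv q (r * τ) * r * L)
    (φ := fun τ => q r * ((Real.log (1 + Ct / τ ^ (2 * d)) + k) * (φ τ * ψ τ))) hαβ
    ((hq.continuousOn.comp (by fun_prop) hdom).mul continuousOn_const)
    (fun τ hτ => (hderiv τ hτ).hasDerivWithinAt)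
    ((hint.mono_set (fun τ hτ => ⟨hα.trans_le hτ.1, hτ.2.trans hβ⟩)).const_mul _) (by
      intro τ hτ
      have hτ0 : 0 < τ := hα.trans hτ.1
      obtain ⟨h1, h2⟩ := hsc r hr τ ⟨hτ0, hτ.2.le.trans hβ⟩
      have hd1 := hdom τ (Ioo_subset_Icc_self hτ)
      have h3 : 0 < q (r * τ) := hq.apply_pos hd1 (mul_pos hr.1 hτ0)
      have h4 : 0 ≤ deriv q (r * τ) := hq.deriv_nonneg hd1 (mul_pos hr.1 hτ0)
      have h5 : deriv q (r * τ) * r ≤ ψ τ * q (r * τ) := by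
        have hr0 := hr.1.ne'
        calc _ ≤ 1 / r * ψ τ * q (r * τ) * r := mul_le_mul_of_nonneg_right h2 hr.1.le
          _ = _ := by field_simp
      have h6 : 0 ≤ ψ τ := by
        have : 0 ≤ ψ τ * q (r * τ) := (mul_nonneg h4 hr.1.le).trans h5
        exact nonneg_of_mul_nonneg_left this h3
      have h7 : ψ τ * q (r * τ) ≤ q r * (φ τ * ψ τ) := by nlinarith
      have h8 : L ≤ Real.log (1 + Ct / τ ^ (2 * d)) + k := by
        rw [hL]
        have := hτ.2.le
        gcongr
      have h9 : 0 ≤ q r * (φ τ * ψ τ) := le_trans (mul_nonneg h6 h3.le) h7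
      calc deriv q (r * τ) * r * L ≤ (q r * (φ τ * ψ τ)) * L := 
          mul_le_mul_of_nonneg_right (h5.trans h7) hL0
        _ ≤ (q r * (φ τ * ψ τ)) * (Real.log (1 + Ct / τ ^ (2 * d)) + k) := by gcongr
        _ = _ := by ring)
  rw [intervalIntegral.integral_const_mul] at key
  linarith

/-- Chaining with scales `δ n` at which `q` halves: `q (δ n)` is then four times the increment of
`q` between `δ (n + 2)` and `δ (n + 1)`, so the chaining sum is dominated by adjacent integrals. -/
theorem exists_abs_sub_average_le {d : ℕ} (hq : IsDifferentiableGauge R q)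
    (hqs : ScalingCondition d R q) :
    ∃ c₀ c₁ c₂ : ℝ, c₀ ∈ gaugeDomain R ∧ 0 < c₀ ∧ c₀ ≤ 1 ∧ 0 ≤ c₁ ∧ 0 ≤ c₂ ∧
      ∀ r ∈ Ioc 0 c₀, ∀ (x : EuclideanSpace ℝ (Fin d)) (f : EuclideanSpace ℝ (Fin d) → ℝ)
        (g : EuclideanSpace ℝ (Fin d) → EuclideanSpace ℝ (Fin d) → ℝ) (Z : ℝ),
        Continuous f → (∀ u v, |f u - f v| ≤ g u v) → 0 ≤ Z →
        ∫⁻ u in Metric.ball x (c₀ / 2 * r), ∫⁻ v in Metric.ball x (c₀ / 2 * r),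
            ENNReal.ofReal (Real.exp (g u v / q ‖u - v‖))
          ≤ ENNReal.ofReal Z * volume (Metric.ball x (c₀ / 2 * r)) ^ 2 →
        ∀ y ∈ Metric.ball x (c₀ / 2 * r),
          |f y - ⨍ u in Metric.ball x (c₀ / 2 * r), f u| ≤ q r * (c₁ + c₂ * Real.log (1 + Z)) := by
  obtain ⟨φ, ψ, hφ, hψ, ⟨c₀, hc, hc0, hc1, hsc⟩, Ct, hCt, hpint⟩ := hqs
  have hint1 := (hpint 1 le_rfl).mono_set (Ioc_subset_Ioc_right hc1)
  simp only [Real.rpow_one] at hint1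
  -- On `(0, c₀]` the logarithmic weight is at least `log (1 + Ct) > 0`, so it can be dropped.
  have hint0 : IntegrableOn (fun τ => φ τ * ψ τ) (Ioc 0 c₀) := by
    refine Integrable.mono' (hint1.norm.const_mul (Real.log (1 + Ct))⁻¹)
      (hφ.mul hψ).aestronglyMeasurable ?_
    filter_upwards [ae_restrict_mem measurableSet_Ioc] with τ hτ
    have h1 : 0 < Real.log (1 + Ct) := Real.log_pos (by linarith)
    have h2 : Real.log (1 + Ct) ≤ Real.log (1 + Ct / τ ^ (2 * d)) := by
      gcongr
      rw [le_div_iff₀ (pow_pos hτ.1 _)]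
      exact mul_le_of_le_one_right hCt.le (pow_le_one₀ hτ.1.le (hτ.2.trans hc1))
    rw [norm_mul (Real.log _), Real.norm_of_nonneg (h1.le.trans h2), ← div_eq_inv_mul,
      le_div_iff₀ h1, mul_comm]
    gcongr
  set J₁ : ℝ := ∫ τ in Ioc 0 c₀, Real.log (1 + Ct / τ ^ (2 * d)) * (φ τ * ψ τ) with hJ₁
  set J₀ : ℝ := ∫ τ in Ioc 0 c₀, φ τ * ψ τ with hJ₀
  -- No sign is assumed on `φ` and `ψ`; the scaling inequalities at `r = c₀` force it.
  have hprod : ∀ τ ∈ Ioc 0 c₀, 0 ≤ φ τ * ψ τ := by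
    intro τ hτ
    obtain ⟨h1, h2⟩ := hsc c₀ ⟨hc0, le_rfl⟩ τ hτ
    have hdom : c₀ * τ ∈ gaugeDomain R := gaugeDomain_mem_of_le hc (mul_nonneg hc0.le hτ.1.le)
      (mul_le_of_le_one_right hc0.le (hτ.2.trans hc1))
    have h3 := hq.apply_pos hc hc0
    have h4 := hq.apply_pos hdom (mul_pos hc0 hτ.1)
    have h5 := hq.deriv_nonneg hdom (mul_pos hc0 hτ.1)
    have h6 : 0 ≤ 1 / c₀ * ψ τ := nonneg_of_mul_nonneg_left (h5.trans h2) h4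
    have h7 : 0 ≤ ψ τ := by
      have : ψ τ = c₀ * (1 / c₀ * ψ τ) := by field_simp
      rw [this]; positivity
    exact mul_nonneg (nonneg_of_mul_nonneg_left (h4.le.trans h1) h3) h7
  have hLnn : ∀ τ, 0 < τ → 0 ≤ Real.log (1 + Ct / τ ^ (2 * d)) := fun τ hτ =>
    Real.log_nonneg (by have : 0 ≤ Ct / τ ^ (2 * d) := by positivity
                        linarith)
  have hJ₀0 : 0 ≤ J₀ := setIntegral_nonneg measurableSet_Ioc hprod
  have hJ₁0 : 0 ≤ J₁ := setIntegral_nonneg measurableSet_Ioc fun τ hτ =>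
    mul_nonneg (hLnn τ hτ.1) (hprod τ hτ)
  have hlogCt : 0 ≤ Real.log (1 + 1 / Ct) := Real.log_nonneg (by
    have : 0 ≤ 1 / Ct := by positivity
    linarith)
  refine ⟨c₀, 4 * (J₁ + (Real.log (1 + 1 / Ct) + 1) * J₀), 4 * J₀, hc, hc0, hc1, by positivity,
    by positivity, ?_⟩
  intro r hr x f g Z hf hfg hZ hZb y hy
  have hrd : r ∈ gaugeDomain R := gaugeDomain_mem_of_le hc hr.1.le hr.2
  have hqr : 0 < q r := hq.apply_pos hrd hr.1
  have hb0 : 0 < c₀ * r := mul_pos hc0 hr.1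
  have hbd : c₀ * r ∈ gaugeDomain R := gaugeDomain_mem_of_le hrd hb0.le
    (mul_le_of_le_one_left hr.1.le hc1)
  set b : ℝ := c₀ * r with hb
  have hqb : 0 < q b := hq.apply_pos hbd hb0
  have hyn : ∀ n : ℕ, (1 / 2 : ℝ) ^ n * q b ∈ Icc 0 (q b) := fun n =>
    ⟨by positivity, mul_le_of_le_one_left hqb.le (pow_le_one₀ (by norm_num) (by norm_num))⟩
  set δ : ℕ → ℝ := fun n => gaugeInv R q ((1 / 2 : ℝ) ^ n * q b) with hδ
  have hδmem : ∀ n, δ n ∈ Icc 0 b := fun n => (hq.gaugeInv_spec hbd (hyn n)).1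
  have hqδ : ∀ n, q (δ n) = (1 / 2 : ℝ) ^ n * q b := fun n => (hq.gaugeInv_spec hbd (hyn n)).2
  have hδdom : ∀ n, δ n ∈ gaugeDomain R := fun n =>
    gaugeDomain_mem_of_le hbd (hδmem n).1 (hδmem n).2
  have hδpos : ∀ n, 0 < δ n := by
    intro n
    rcases (hδmem n).1.lt_or_eq with h | h
    · exact h
    · have := hqδ n
      rw [← h, hq.zero] at this
      have : 0 < (1 / 2 : ℝ) ^ n * q b := by positivity
      linarith
  have hδ0 : δ 0 = b := by
    refine hq.strictMonoOn.injOn (hδdom 0) hbd ?_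
    rw [hqδ]; simp
  have hδanti : Antitone δ := by
    intro m n hmn
    rw [← hq.strictMonoOn.le_iff_le (hδdom n) (hδdom m), hqδ, hqδ]
    gcongr ?_ * _
    exact pow_le_pow_of_le_one (by norm_num) (by norm_num) hmn
  have hδlim : Filter.Tendsto δ Filter.atTop (nhds 0) := by
    rw [tendsto_order]
    refine ⟨fun e he => Filter.Eventually.of_forall fun n => he.trans (hδpos n), fun e he => ?_⟩
    have he' : min e b ∈ gaugeDomain R :=
      gaugeDomain_mem_of_le hbd (le_min he.le hb0.le) (min_le_right _ _)
    have hqe : 0 < q (min e b) := hq.apply_pos he' (lt_min he hb0)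
    have h1 : Filter.Tendsto (fun n : ℕ => (1 / 2 : ℝ) ^ n * q b) Filter.atTop (nhds 0) := by
      simpa using (tendsto_pow_atTop_nhds_zero_of_lt_one (r := (1 / 2 : ℝ)) (by norm_num)
        (by norm_num)).mul_const (q b)
    filter_upwards [h1.eventually (gt_mem_nhds hqe)] with n hn
    rw [← hqδ, hq.strictMonoOn.lt_iff_lt (hδdom n) he'] at hn
    exact hn.trans_le (min_le_left _ _)
  set ℓ : ℝ := Real.log (1 + Z / Ct) with hℓ
  have hℓ0 : 0 ≤ ℓ := Real.log_nonneg (by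
    have : 0 ≤ Z / Ct := by positivity
    linarith)
  have hℓle : ℓ ≤ Real.log (1 + 1 / Ct) + Real.log (1 + Z) := by
    rw [← Real.log_mul (by positivity) (by positivity), hℓ]
    apply Real.log_le_log (by positivity)
    have : 0 ≤ 1 / Ct := by positivity
    have h3 : Z / Ct = 1 / Ct * Z := by ring
    rw [h3]; nlinarith
  set G : ℝ → ℝ := fun τ => (Real.log (1 + Ct / τ ^ (2 * d)) + (ℓ + 1)) * (φ τ * ψ τ) with hG
  have hGint : IntegrableOn G (Ioc 0 c₀) := by
    have := hint1.add (hint0.const_mul (ℓ + 1))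
    refine this.congr (Filter.Eventually.of_forall fun τ => ?_)
    simp [hG]; ring
  have hGtot : ∫ τ in Ioc 0 c₀, G τ = J₁ + (ℓ + 1) * J₀ := by
    rw [hJ₁, hJ₀, ← integral_const_mul, ← integral_add hint1 (hint0.const_mul (ℓ + 1))]
    refine integral_congr_ae (Filter.Eventually.of_forall fun τ => ?_)
    simp [hG]; ring
  have hGnn : ∀ τ ∈ Ioc 0 c₀, 0 ≤ G τ := fun τ hτ =>
    mul_nonneg (by have := hLnn τ hτ.1; linarith) (hprod τ hτ)
  have hτpos : ∀ n, 0 < δ n / r := fun n => div_pos (hδpos n) hr.1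
  have hτle : ∀ n, δ n / r ≤ c₀ := fun n => by
    rw [div_le_iff₀ hr.1]; exact (hδmem n).2
  have hGii : ∀ i j, IntervalIntegrable G volume (δ i / r) (δ j / r) := by
    intro i j
    rw [intervalIntegrable_iff]
    refine hGint.mono_set fun τ hτ => ?_
    rw [uIoc, mem_Ioc] at hτ
    exact ⟨(lt_min (hτpos i) (hτpos j)).trans hτ.1, hτ.2.trans (max_le (hτle i) (hτle j))⟩
  -- Since `(1 + Ct / e) * (1 + Z / Ct) ≥ Z / e`, this choice separates the scale from `Z` while
  -- meeting the requirement of the chain.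
  set lam : ℕ → ℝ := fun n => Real.log (1 + Ct / (δ (n + 1) / r) ^ (2 * d)) + ℓ with hlam
  have hlamnn : ∀ n, 0 ≤ lam n := fun n => add_nonneg (hLnn _ (hτpos _)) hℓ0
  have hterm : ∀ n, q (δ n) * (lam n + 1) ≤ 4 * (q r * ∫ τ in (δ (n + 2) / r)..(δ (n + 1) / r), G τ) := by
    intro n
    have h1 := gauge_increment_mul_le (d := d) (k := ℓ + 1) hq hc hc1 hsc hCt (by linarith) hGint hr
      (hτpos (n + 2)) (by have := hδanti (Nat.le_succ (n + 1)); have := hr.1; gcongr) (hτle (n + 1))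
    rw [mul_div_cancel₀ _ hr.1.ne', mul_div_cancel₀ _ hr.1.ne', hqδ, hqδ] at h1
    rw [hqδ, hlam]
    calc _ = 4 * (((1 / 2 : ℝ) ^ (n + 1) * q b - (1 / 2 : ℝ) ^ (n + 2) * q b) *
          (Real.log (1 + Ct / (δ (n + 1) / r) ^ (2 * d)) + (ℓ + 1))) := by ring
      _ ≤ _ := by gcongr
  have hsum : ∀ N, ∑ n ∈ Finset.range N, q (δ n) * (lam n + 1) ≤ 4 * (q r * (J₁ + (ℓ + 1) * J₀)) := by
    intro N
    calc _ ≤ ∑ n ∈ Finset.range N, 4 * (q r * ∫ τ in (δ (n + 2) / r)..(δ (n + 1) / r), G τ) :=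
          Finset.sum_le_sum fun n _ => hterm n
      _ = 4 * (q r * ∑ n ∈ Finset.range N, ∫ τ in (δ (n + 2) / r)..(δ (n + 1) / r), G τ) := by
          rw [Finset.mul_sum, Finset.mul_sum]
      _ = 4 * (q r * ∫ τ in (δ (N + 1) / r)..(δ 1 / r), G τ) := by
          congr 2
          rw [intervalIntegral.integral_symm,
            ← intervalIntegral.sum_integral_adjacent_intervals (a := fun n => δ (n + 1) / r) (n := N)
              (fun n _ => hGii _ _), ← Finset.sum_neg_distrib]
          refine Finset.sum_congr rfl fun n _ => ?_
          rw [intervalIntegral.integral_symm]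
      _ ≤ 4 * (q r * (J₁ + (ℓ + 1) * J₀)) := by
          rw [← hGtot, intervalIntegral.integral_of_le (by
            have := hδanti (show 1 ≤ N + 1 by omega); have := hr.1; gcongr)]
          gcongr 4 * (q r * ?_)
          refine setIntegral_mono_set hGint ?_ (Filter.Eventually.of_forall fun τ hτ =>
            ⟨(hτpos _).trans hτ.1, hτ.2.trans (hτle 1)⟩)
          filter_upwards [ae_restrict_mem measurableSet_Ioc] with τ hτ using hGnn τ hτ
  -- The ball has diameter `b = δ 0`, so ratio `δ n / b` makes the `n`-th ball have diameter `δ n`.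
  have hmain := abs_sub_average_le_of_chain hf hy (t := fun n => δ n / b)
    (s := fun u v => g u v / q ‖u - v‖) (w := fun n => q (δ n)) (l := lam) (Z := Z)
    (S := 4 * (q r * (J₁ + (ℓ + 1) * J₀)))
    (by simp [hδ0, hb0.ne']) (fun n => div_pos (hδpos n) hb0)
    (fun m n hmn => by have := hδanti hmn; simp only; gcongr) (by simpa using hδlim.div_const b)
    (fun n => hq.apply_nonneg (hδdom n)) hlamnn ?_ hZ hZb ?_ hsum
  · refine hmain.trans ?_
    have : (ℓ + 1) * J₀ ≤ (Real.log (1 + 1 / Ct) + Real.log (1 + Z) + 1) * J₀ := by gcongr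
    nlinarith
  · intro n u hu v hv huv
    have h1 : dist u v < δ n := by
      have : 2 * (c₀ / 2 * r) * (δ n / b) = δ n := by
        have hr0 := hr.1.ne'
        rw [hb]; field_simp
      rwa [this] at huv
    rw [dist_eq_norm] at h1
    have hdu : ‖u - v‖ ∈ gaugeDomain R := gaugeDomain_mem_of_le (hδdom n) (norm_nonneg _) h1.le
    -- On the diagonal `q 0 = 0` and division by zero gives `0`, matching `f u - f u = 0`.
    rcases eq_or_ne u v with rfl | hne
    · simp [hq.zero]
    · have h2 : 0 < q ‖u - v‖ := hq.apply_pos hdu (norm_pos_iff.2 (sub_ne_zero.2 hne))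
      have h3 : q ‖u - v‖ ≤ q (δ n) := hq.strictMonoOn.monotoneOn hdu (hδdom n) h1.le
      refine (hfg u v).trans ?_
      have h4 : 0 ≤ g u v := (abs_nonneg _).trans (hfg u v)
      calc g u v = q ‖u - v‖ * (g u v / q ‖u - v‖) := by field_simp
        _ ≤ _ := by gcongr
  · intro n
    have hp1 := hτpos (n + 1)
    simp only [hlam, hℓ]
    rw [← Real.log_mul (by positivity) (by positivity), Real.exp_log (by positivity)]
    set e := (δ (n + 1) / r) ^ (2 * d) with he
    have he0 : 0 < e := by positivity
    have h5 : e ≤ (δ n / b) ^ d * (δ (n + 1) / b) ^ d := by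
      have h6 : δ (n + 1) / r ≤ δ (n + 1) / b := by
        have := (hδpos (n + 1)).le
        have : b ≤ r := mul_le_of_le_one_left hr.1.le hc1
        gcongr
      have h7 : δ (n + 1) / b ≤ δ n / b := by
        have := hδanti (Nat.le_succ n); gcongr
      rw [he, two_mul, pow_add]
      exact mul_le_mul (pow_le_pow_left₀ hp1.le (h6.trans h7) d) (pow_le_pow_left₀ hp1.le h6 d)
        (by positivity) (by have := hδpos n; positivity)
    calc Z / ((δ n / b) ^ d * (δ (n + 1) / b) ^ d) ≤ Z / e := by gcongr
      _ = Ct / e * (Z / Ct) := by field_simp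
      _ ≤ _ := by
        have h8 : 0 ≤ Ct / e := by positivity
        have h9 : 0 ≤ Z / Ct := by positivity
        nlinarith

end Gauge

/-! ### One-dimensional Gaussian estimates. -/

section GaussianReal

theorem gaussianReal_apply_le_of_pdf_le {m c : ℝ} {v : ℝ≥0} (hv : v ≠ 0) {s : Set ℝ}
    (h : ∀ x ∈ s, gaussianPDFReal m v x ≤ c) :
    gaussianReal m v s ≤ ENNReal.ofReal c * volume s := by
  rw [gaussianReal_apply _ hv, ← setLIntegral_const]
  exact setLIntegral_mono measurable_const fun x hx => ENNReal.ofReal_le_ofReal (h x hx)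

theorem inv_sqrt_two_pi_mul_le {v : ℝ} : (√(2 * Real.pi * v))⁻¹ ≤ (√v)⁻¹ := by
  rcases le_or_gt v 0 with hv | hv
  · rw [Real.sqrt_eq_zero_of_nonpos hv, Real.sqrt_eq_zero_of_nonpos]
    nlinarith [Real.pi_pos]
  · have := Real.pi_gt_three
    gcongr
    nlinarith

theorem gaussianReal_closedEBall_le {m z : ℝ} {v : ℝ≥0} (hv : v ≠ 0) (K : ℝ≥0∞) :
    gaussianReal m v (Metric.closedEBall z K) ≤ ENNReal.ofReal (√v)⁻¹ * (2 * K) := by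
  rw [← Real.volume_closedEBall z K]
  refine gaussianReal_apply_le_of_pdf_le hv fun x _ => ?_
  rw [gaussianPDFReal]
  refine (mul_le_of_le_one_right (by positivity) (Real.exp_le_one_iff.2 ?_)).trans
    inv_sqrt_two_pi_mul_le
  exact div_nonpos_of_nonpos_of_nonneg (neg_nonpos.2 (sq_nonneg _)) (by positivity)

/-- Uniform in `m`, `z`, `v`, which is what permits an arbitrary mean. With `L = |z - m|` and `κ <
1/4`, the set has length at most `8 * κ * L` and stays at distance at least `L / 2` from `m`, where
the density decays enough to offset `L`. -/
theorem gaussianReal_abs_sub_le_mul_abs_sub_le {m z κ : ℝ} {v : ℝ≥0} (hv : v ≠ 0) (hκ : 0 ≤ κ) :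
    gaussianReal m v {x | |x - z| ≤ 2 * κ * |x - m|} ≤ ENNReal.ofReal (16 * κ) := by
  rcases le_or_gt (1 / 4) κ with h | h
  · refine prob_le_one.trans ?_
    rw [ENNReal.one_le_ofReal]; linarith
  have hv0 : (0 : ℝ) < v := by positivity
  have hsv : 0 < √(v : ℝ) := Real.sqrt_pos.2 hv0
  set L : ℝ := |z - m| with hL
  have hL0 : 0 ≤ L := abs_nonneg _
  have hsub : {x | |x - z| ≤ 2 * κ * |x - m|} ⊆ {x | x ∈ Metric.closedBall z (4 * κ * L) ∧ L / 2 ≤ |x - m|} := by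
    intro x hx
    have hx : |x - z| ≤ 2 * κ * |x - m| := hx
    have h1 : |x - m| ≤ |x - z| + L := abs_sub_le x z m
    have h2 : L ≤ |x - z| + |x - m| := by
      rw [hL, abs_sub_comm x z]; exact abs_sub_le z x m
    have h0 := abs_nonneg (x - m)
    have h3 : 2 * κ * |x - m| ≤ 1 / 2 * |x - m| := by gcongr; linarith
    have h4 : |x - m| ≤ 2 * L := by linarith
    refine ⟨?_, by linarith⟩
    rw [Metric.mem_closedBall, Real.dist_eq]
    nlinarith
  refine (measure_mono hsub).trans ?_
  refine (gaussianReal_apply_le_of_pdf_le (c := (√v)⁻¹ * (1 + L ^ 2 / (8 * v))⁻¹) hv ?_).trans ?_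
  · intro x hx
    rw [gaussianPDFReal]
    have h1 : -(x - m) ^ 2 / (2 * v) ≤ -(L ^ 2 / (8 * v)) := by
      rw [neg_div, neg_le_neg_iff, div_le_div_iff₀ (by positivity) (by positivity)]
      have h2 : L ^ 2 ≤ 4 * (x - m) ^ 2 := by
        rw [← sq_abs (x - m)]
        have := hx.2
        nlinarith
      nlinarith
    have h3 : Real.exp (-(L ^ 2 / (8 * v))) ≤ (1 + L ^ 2 / (8 * v))⁻¹ := by
      rw [Real.exp_neg]
      gcongr
      linarith [Real.add_one_le_exp (L ^ 2 / (8 * (v : ℝ)))]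
    exact mul_le_mul inv_sqrt_two_pi_mul_le ((Real.exp_le_exp.2 h1).trans h3) (by positivity)
      (by positivity)
  · refine (mul_le_mul_right (measure_mono (fun x hx => hx.1)) _).trans ?_
    rw [Real.volume_closedBall, ← ENNReal.ofReal_mul (by positivity)]
    apply ENNReal.ofReal_le_ofReal
    set t := L / √(v : ℝ) with ht
    have e1 : L ^ 2 / (8 * (v : ℝ)) = t ^ 2 / 8 := by
      rw [ht, div_pow, Real.sq_sqrt hv0.le]; ring
    have e2 : (√(v : ℝ))⁻¹ * (1 + t ^ 2 / 8)⁻¹ * (2 * (4 * κ * L)) = 8 * κ * (t / (1 + t ^ 2 / 8)) := by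
      rw [ht]; ring
    rw [e1, e2]
    have h4 : t / (1 + t ^ 2 / 8) ≤ 2 := by
      rw [div_le_iff₀ (by positivity)]
      nlinarith [sq_nonneg (t - 2)]
    nlinarith

end GaussianReal

/-! ### Probability that a Gaussian process comes close to a level. -/

section SmallBall

variable {Ω : Type*} [MeasurableSpace Ω] {P : Measure Ω}

/-- From `g ≤ e + g² / e`; unlike Cauchy–Schwarz this asks no measurability of `g`, at the price of
the factor `2`. -/
theorem lintegral_le_two_mul_of_lintegral_sq_le [IsProbabilityMeasure P] {g : Ω → ℝ≥0∞} {e : ℝ}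
    (he : 0 < e) (h : ∫⁻ ω, g ω ^ 2 ∂P ≤ ENNReal.ofReal (e ^ 2)) :
    ∫⁻ ω, g ω ∂P ≤ ENNReal.ofReal (2 * e) := by
  have he0 : ENNReal.ofReal e ≠ 0 := by simpa using he
  have hpt : ∀ ω, g ω ≤ ENNReal.ofReal e + (ENNReal.ofReal e)⁻¹ * g ω ^ 2 := by
    intro ω
    rcases le_total (g ω) (ENNReal.ofReal e) with h1 | h1
    · exact h1.trans le_self_add
    · refine le_trans ?_ le_add_self
      calc g ω = (ENNReal.ofReal e)⁻¹ * (ENNReal.ofReal e * g ω) := by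
            rw [← mul_assoc, ENNReal.inv_mul_cancel he0 ENNReal.ofReal_ne_top, one_mul]
        _ ≤ _ := by rw [pow_two]; gcongr
  calc ∫⁻ ω, g ω ∂P ≤ ∫⁻ ω, (ENNReal.ofReal e + (ENNReal.ofReal e)⁻¹ * g ω ^ 2) ∂P :=
        lintegral_mono hpt
    _ = ENNReal.ofReal e + (ENNReal.ofReal e)⁻¹ * ∫⁻ ω, g ω ^ 2 ∂P := by
        rw [lintegral_add_left measurable_const,
          lintegral_const_mul' _ _ (ENNReal.inv_ne_top.2 he0)]
        simp
    _ ≤ ENNReal.ofReal e + (ENNReal.ofReal e)⁻¹ * ENNReal.ofReal (e ^ 2) := by gcongr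
    _ = ENNReal.ofReal (2 * e) := by
        rw [← ENNReal.ofReal_inv_of_pos he, ← ENNReal.ofReal_mul (by positivity),
          ← ENNReal.ofReal_add he.le (by positivity)]
        congr 1
        field_simp
        ring

theorem covariance_sq_le_variance_mul_variance [IsProbabilityMeasure P] {X Y : Ω → ℝ}
    (hX : MemLp X 2 P) (hY : MemLp Y 2 P) :
    cov[Y, X; P] ^ 2 ≤ Var[Y; P] * Var[X; P] := by
  have h : ∀ t : ℝ, 0 ≤ Var[Y; P] - 2 * t * cov[Y, X; P] + t ^ 2 * Var[X; P] := by
    intro t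
    have h1 := variance_nonneg (fun ω => Y ω - t * X ω) P
    rw [variance_fun_sub hY (hX.const_mul t), variance_const_mul, covariance_const_mul_right] at h1
    linarith
  have := discrim_le_zero (a := Var[X; P]) (b := -2 * cov[Y, X; P]) (c := Var[Y; P]) fun t => by
    have := h t; nlinarith
  rw [discrim] at this
  nlinarith

/-- Probability that a Gaussian variable `X` is within a random distance, proportional to
`ε + W`, of `z`, when `W` is independent of `X`. -/
theorem measure_enorm_sub_le_of_indepFun [IsProbabilityMeasure P] {X : Ω → ℝ} {W : Ω → ℝ≥0∞}
    (hX : Measurable X) (hW : Measurable W) (hind : IndepFun X W P) {m z : ℝ} {v : ℝ≥0}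
    (hv : v ≠ 0) (hlaw : P.map X = gaussianReal m v) (ε : ℝ≥0∞) :
    P {ω | ‖X ω - z‖ₑ ≤ 2 * (ε + W ω)} ≤
      ENNReal.ofReal (√v)⁻¹ * (4 * (ε + ∫⁻ ω, W ω ∂P)) := by
  set S : Set (ℝ × ℝ≥0∞) := {p | ‖p.1 - z‖ₑ ≤ 2 * (ε + p.2)} with hS
  have hSm : MeasurableSet S := measurableSet_le (by fun_prop) (by fun_prop)
  have h1 : P {ω | ‖X ω - z‖ₑ ≤ 2 * (ε + W ω)} = P.map (fun ω => (X ω, W ω)) S := by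
    rw [Measure.map_apply (hX.prodMk hW) hSm]; rfl
  have : IsProbabilityMeasure (P.map W) := Measure.isProbabilityMeasure_map hW.aemeasurable
  rw [h1, (indepFun_iff_map_prod_eq_prod_map_map hX.aemeasurable hW.aemeasurable).1 hind, hlaw,
    Measure.prod_apply_symm hSm]
  calc ∫⁻ w, gaussianReal m v ((fun x => (x, w)) ⁻¹' S) ∂(P.map W)
      ≤ ∫⁻ w, ENNReal.ofReal (√v)⁻¹ * (4 * (ε + w)) ∂(P.map W) := by
        refine lintegral_mono fun w => ?_
        have : (fun x => (x, w)) ⁻¹' S = Metric.closedEBall z (2 * (ε + w)) := by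
          ext x
          simp [hS, edist_eq_enorm_sub]
        rw [this]
        refine (gaussianReal_closedEBall_le hv _).trans_eq ?_
        ring
    _ = _ := by
        rw [lintegral_map (by fun_prop) hW, lintegral_const_mul' _ _ ENNReal.ofReal_ne_top,
          lintegral_const_mul' _ _ (by norm_num), lintegral_add_left measurable_const]
        simp

/-- Write `X y = (1 + c y) * X x + V y` with `V` independent of `X x`. If some `X y` is within `ε`
of `z`, then `X x` is within `2 * κ * |X x - m|` of `z`, or within `2 * (ε + W)` with `W`
independent of `X x` and of mean at most `4 * e`. The two cases contribute `16 * e / √v` and `4 * (ε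
+ 4 * e) / √v`. -/
theorem measure_exists_abs_sub_lt_le {ι : Type*} {X : ι → Ω → ℝ} (hX : ∀ i, Measurable (X i))
    (hG : IsGaussianProcess X P) {x : ι} {T : Set ι} (hT : T.Countable) {σ e : ℝ} (hσ : 0 < σ)
    (hvar : σ ^ 2 ≤ Var[X x; P]) (he : 0 < e)
    (hosc : ∫⁻ ω, (⨆ y ∈ T, ‖X y ω - X x ω‖ₑ) ^ 2 ∂P ≤ ENNReal.ofReal (e ^ 2))
    (z : ℝ) {ε : ℝ} (hε : 0 ≤ ε) :
    P {ω | ∃ y ∈ T, |X y ω - z| < ε} ≤ ENNReal.ofReal ((32 * e + 4 * ε) / σ) := by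
  have : IsProbabilityMeasure P := hG.isProbabilityMeasure
  have hL2 : ∀ i, MemLp (X i) 2 P := fun i => (hG.hasGaussianLaw_eval i).memLp_two
  have hint : ∀ i, Integrable (X i) P := fun i => (hL2 i).integrable one_le_two
  set m : ℝ := P[X x] with hm
  set v : ℝ := Var[X x; P] with hv
  have hv0 : 0 < v := (pow_pos hσ 2).trans_le hvar
  have hsv : 0 < √v := Real.sqrt_pos.2 hv0
  have hσv : σ ≤ √v := Real.le_sqrt_of_sq_le hvar
  have hlaw : P.map (X x) = gaussianReal m v.toNNReal :=
    (hG.hasGaussianLaw_eval x).map_eq_gaussianReal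
  have hv' : v.toNNReal ≠ 0 := by simpa using hv0
  have hcoe : ((v.toNNReal : ℝ≥0) : ℝ) = v := Real.coe_toNNReal _ hv0.le
  set c : ι → ℝ := fun y => cov[fun ω => X y ω - X x ω, X x; P] / v with hc
  set κ : ℝ := e / √v with hκ
  have hκ0 : 0 ≤ κ := by positivity
  -- By Cauchy–Schwarz, the increment having variance at most `e ^ 2`.
  have hcκ : ∀ y ∈ T, |c y| ≤ κ := by
    intro y hy
    have hD : MemLp (fun ω => X y ω - X x ω) 2 P := (hL2 y).sub (hL2 x)
    have h1 : Var[fun ω => X y ω - X x ω; P] ≤ e ^ 2 := by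
      refine (variance_le_expectation_sq hD.aestronglyMeasurable).trans ?_
      rw [integral_eq_lintegral_of_nonneg_ae (Filter.Eventually.of_forall fun ω => by
        simp only [Pi.pow_apply, Pi.zero_apply]; positivity)
        (by simpa using (hD.aestronglyMeasurable.pow 2))]
      refine ENNReal.toReal_le_of_le_ofReal (by positivity) (le_trans ?_ hosc)
      refine lintegral_mono fun ω => ?_
      have : ENNReal.ofReal (((fun ω => X y ω - X x ω) ^ 2) ω) = ‖X y ω - X x ω‖ₑ ^ 2 := by
        simp only [Pi.pow_apply]
        rw [← sq_abs, ENNReal.ofReal_pow (abs_nonneg _), Real.enorm_eq_ofReal_abs]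
      rw [this]
      gcongr
      exact le_iSup₂ (f := fun y (_ : y ∈ T) => ‖X y ω - X x ω‖ₑ) y hy
    have h2 := covariance_sq_le_variance_mul_variance (hL2 x) hD
    have h3 : cov[fun ω => X y ω - X x ω, X x; P] ^ 2 ≤ (e * √v) ^ 2 := by
      rw [mul_pow, Real.sq_sqrt hv0.le]
      exact h2.trans (by gcongr)
    have h4 := abs_le_of_sq_le_sq h3 (by positivity)
    rw [hc, hκ]
    simp only
    rw [abs_div, abs_of_pos hv0, div_le_div_iff₀ hv0 hsv]
    calc _ ≤ e * √v * √v := by gcongr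
      _ = e * v := by rw [mul_assoc, Real.mul_self_sqrt hv0.le]
  set V : ι → Ω → ℝ := fun y ω => X y ω - (1 + c y) * X x ω with hV
  have hVm : ∀ y, Measurable (V y) := fun y => (hX y).sub ((hX x).const_mul _)
  have hVG : IsGaussianProcess (Sum.elim (fun _ : Unit => X x) V) P := by
    classical
    refine hG.of_isGaussianProcess fun s => ?_
    rcases s with s | y
    · exact ⟨{x}, ContinuousLinearMap.proj ⟨x, by simp⟩, fun ω => by simp⟩
    · exact ⟨{x, y}, ContinuousLinearMap.proj (R := ℝ) (φ := fun _ => ℝ) ⟨y, by simp⟩ -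
        (1 + c y) • ContinuousLinearMap.proj (R := ℝ) (φ := fun _ => ℝ) ⟨x, by simp⟩, fun ω => by simp [hV]⟩
  have hcov : ∀ (s : Unit) (y : ι), cov[X x, V y; P] = 0 := by
    intro _ y
    have h1 : cov[fun ω => X y ω - X x ω, X x; P] = cov[X y, X x; P] - v := by
      rw [covariance_fun_sub_left (hL2 y) (hL2 x) (hL2 x), covariance_self (hX x).aemeasurable]
    have h2 : c y * v = cov[X y, X x; P] - v := by
      rw [hc]; simp only; rw [div_mul_cancel₀ _ hv0.ne', h1]
    rw [hV]
    simp only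
    rw [covariance_fun_sub_right (hL2 x) (hL2 y) ((hL2 x).const_mul _), covariance_const_mul_right,
      covariance_self (hX x).aemeasurable, covariance_comm, ← hv]
    linarith
  have hind := hVG.indepFun_of_covariance_eq_zero (fun _ => (hX x).aemeasurable)
    (fun y => (hVm y).aemeasurable) hcov
  -- The shift by `c y * m` turns `V y` into `(X y - X x) - c y * (X x - m)`, which is of order `e`
  -- even when the mean `m` is large.
  set F : (ι → ℝ) → ℝ≥0∞ := fun p => ⨆ y ∈ T, ‖p y + c y * m‖ₑ with hF
  have hFm : Measurable F := by
    refine Measurable.biSup T hT fun y _ => ?_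
    fun_prop
  set W : Ω → ℝ≥0∞ := fun ω => F (fun y => V y ω) with hW
  have hWm : Measurable W := hFm.comp (measurable_pi_lambda _ hVm)
  have hindW : IndepFun (X x) W P :=
    hind.comp (φ := fun p : Unit → ℝ => p ()) (measurable_pi_apply _) hFm
  have hWint : ∫⁻ ω, W ω ∂P ≤ ENNReal.ofReal (4 * e) := by
    have h1 : ∀ ω, W ω ≤ (⨆ y ∈ T, ‖X y ω - X x ω‖ₑ) + ENNReal.ofReal κ * ‖X x ω - m‖ₑ := by
      intro ω
      refine iSup₂_le fun y hy => ?_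
      have h2 : V y ω + c y * m = (X y ω - X x ω) - c y * (X x ω - m) := by rw [hV]; ring
      rw [h2]
      refine (enorm_sub_le).trans (add_le_add
        (le_iSup₂ (f := fun y (_ : y ∈ T) => ‖X y ω - X x ω‖ₑ) y hy) ?_)
      rw [enorm_mul]
      gcongr
      rw [Real.enorm_eq_ofReal_abs]
      exact ENNReal.ofReal_le_ofReal (hcκ y hy)
    have h3 : ∫⁻ ω, ‖X x ω - m‖ₑ ∂P ≤ ENNReal.ofReal (2 * √v) := by
      refine lintegral_le_two_mul_of_lintegral_sq_le hsv ?_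
      rw [Real.sq_sqrt hv0.le, hv, ofReal_variance (hL2 x), evariance]
    calc ∫⁻ ω, W ω ∂P ≤ ∫⁻ ω, ((⨆ y ∈ T, ‖X y ω - X x ω‖ₑ) + ENNReal.ofReal κ * ‖X x ω - m‖ₑ) ∂P :=
          lintegral_mono h1
      _ = ∫⁻ ω, (⨆ y ∈ T, ‖X y ω - X x ω‖ₑ) ∂P + ENNReal.ofReal κ * ∫⁻ ω, ‖X x ω - m‖ₑ ∂P := by
          rw [lintegral_add_left, lintegral_const_mul' _ _ ENNReal.ofReal_ne_top]
          exact Measurable.biSup T hT fun y _ => ((hX y).sub (hX x)).enorm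
      _ ≤ ENNReal.ofReal (2 * e) + ENNReal.ofReal κ * ENNReal.ofReal (2 * √v) := by
          gcongr
          exact lintegral_le_two_mul_of_lintegral_sq_le he hosc
      _ = ENNReal.ofReal (4 * e) := by
          rw [← ENNReal.ofReal_mul hκ0, ← ENNReal.ofReal_add (by positivity) (by positivity), hκ]
          congr 1
          field_simp
          ring
  have hsub : {ω | ∃ y ∈ T, |X y ω - z| < ε} ⊆
      (X x ⁻¹' {a | |a - z| ≤ 2 * κ * |a - m|}) ∪
        {ω | ‖X x ω - z‖ₑ ≤ 2 * (ENNReal.ofReal ε + W ω)} := by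
    rintro ω ⟨y, hy, hyz⟩
    by_contra hcon
    simp only [mem_union, mem_preimage, mem_ofPred_eq, not_or, not_le] at hcon
    obtain ⟨h1, h2⟩ := hcon
    have h3 : ‖V y ω + c y * m‖ₑ ≤ W ω :=
      le_iSup₂ (f := fun y (_ : y ∈ T) => ‖V y ω + c y * m‖ₑ) y hy
    have h4 : 2 * (ε + |V y ω + c y * m|) < |X x ω - z| := by
      have h5 : 2 * (ENNReal.ofReal ε + ‖V y ω + c y * m‖ₑ) < ‖X x ω - z‖ₑ :=
        lt_of_le_of_lt (by gcongr) h2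
      rw [Real.enorm_eq_ofReal_abs, Real.enorm_eq_ofReal_abs,
        ← ENNReal.ofReal_add hε (abs_nonneg _), ← ENNReal.ofReal_ofNat,
        ← ENNReal.ofReal_mul (by norm_num)] at h5
      exact (ENNReal.ofReal_lt_ofReal_iff_of_nonneg (by positivity)).1 h5
    have h6 : X x ω - z = (X y ω - z) - c y * (X x ω - m) - (V y ω + c y * m) := by rw [hV]; ring
    have h7 : |X x ω - z| ≤ |X y ω - z| + |c y * (X x ω - m)| + |V y ω + c y * m| := by
      rw [h6]
      exact (abs_sub _ _).trans (by gcongr; exact abs_sub _ _)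
    have h8 : |c y * (X x ω - m)| ≤ κ * |X x ω - m| := by
      rw [abs_mul]; gcongr; exact hcκ y hy
    linarith
  have hmeas : MeasurableSet {a : ℝ | |a - z| ≤ 2 * κ * |a - m|} :=
    measurableSet_le (by fun_prop) (by fun_prop)
  calc P {ω | ∃ y ∈ T, |X y ω - z| < ε}
      ≤ P (X x ⁻¹' {a | |a - z| ≤ 2 * κ * |a - m|}) +
        P {ω | ‖X x ω - z‖ₑ ≤ 2 * (ENNReal.ofReal ε + W ω)} :=
        (measure_mono hsub).trans (measure_union_le _ _)
    _ ≤ ENNReal.ofReal (16 * κ) +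
        ENNReal.ofReal (√v)⁻¹ * (4 * (ENNReal.ofReal ε + ENNReal.ofReal (4 * e))) := by
        refine add_le_add ?_ ?_
        · rw [← Measure.map_apply (hX x) hmeas, hlaw]
          exact gaussianReal_abs_sub_le_mul_abs_sub_le hv' hκ0
        · refine (measure_enorm_sub_le_of_indepFun (hX x) hWm hindW hv' hlaw _).trans ?_
          rw [hcoe]
          gcongr
    _ = ENNReal.ofReal ((32 * e + 4 * ε) / √v) := by
        rw [← ENNReal.ofReal_add hε (by positivity), ← ENNReal.ofReal_ofNat,
          ← ENNReal.ofReal_mul (by norm_num), ← ENNReal.ofReal_mul (by positivity),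
          ← ENNReal.ofReal_add (by positivity) (by positivity), hκ]
        congr 1
        field_simp
        ring
    _ ≤ ENNReal.ofReal ((32 * e + 4 * ε) / σ) := by
        apply ENNReal.ofReal_le_ofReal
        gcongr

end SmallBall

/-! ### Covering numbers of a compact set. -/

section Covering

/-- Vitali: disjoint balls of radius `a / 5` whose fourfold enlargements cover `K`; they all lie in
the `1`-thickening of `K`, whose finite volume bounds their number. -/
theorem exists_finset_cover_card_le {d : ℕ} {K : Set (EuclideanSpace ℝ (Fin d))} (hK : IsCompact K) :
    ∃ C : ℝ, 0 ≤ C ∧ ∀ a ∈ Ioc (0 : ℝ) 1, ∃ F : Finset (EuclideanSpace ℝ (Fin d)), ↑F ⊆ K ∧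
      K ⊆ ⋃ x ∈ F, Metric.ball x a ∧ (F.card : ℝ) ≤ C / a ^ d := by
  set V : ℝ := volume.real (Metric.cthickening 1 K) with hV
  set b : ℝ := volume.real (Metric.ball (0 : EuclideanSpace ℝ (Fin d)) 1) with hb
  have hVt : volume (Metric.cthickening 1 K) ≠ ∞ := hK.isBounded.cthickening.measure_lt_top.ne
  have hb0 : 0 < b := ENNReal.toReal_pos (Metric.measure_ball_pos _ _ one_pos).ne'
    measure_ball_lt_top.ne
  refine ⟨V * 5 ^ d / b, by positivity, fun a ha => ?_⟩
  have ha5 : 0 < a / 5 := by linarith [ha.1]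
  obtain ⟨u, huK, hdisj, hcov⟩ := Vitali.exists_disjoint_subfamily_covering_enlargement_closedBall
    K (fun x => x) (fun _ => a / 5) (a / 5) (fun _ _ => le_rfl) 4 (by norm_num)
  have hcov' : K ⊆ ⋃ x ∈ u, Metric.ball x a := by
    intro y hy
    obtain ⟨x, hx, hsub⟩ := hcov y hy
    refine mem_iUnion₂.2 ⟨x, hx, ?_⟩
    have := hsub (Metric.mem_closedBall_self ha5.le)
    rw [Metric.mem_closedBall] at this
    rw [Metric.mem_ball]
    linarith [ha.1]
  obtain ⟨s, hsu, hsfin, hscov⟩ := hK.elim_finite_subcover_image (fun x _ => Metric.isOpen_ball) hcov'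
  refine ⟨hsfin.toFinset, by simpa using hsu.trans huK, by simpa using hscov, ?_⟩
  have hvol : ∀ x : EuclideanSpace ℝ (Fin d), volume.real (Metric.ball x (a / 5)) = (a / 5) ^ d * b := by
    intro x
    have := volume_ball_smul_radius (0 : EuclideanSpace ℝ (Fin d)) x (a := 1) ha5
    rw [mul_one] at this
    rw [measureReal_def, this, ENNReal.toReal_mul, ENNReal.toReal_ofReal (by positivity)]
    rfl
  have hsum : ∑ x ∈ hsfin.toFinset, volume.real (Metric.ball x (a / 5)) ≤ V := by
    rw [← measureReal_biUnion_finset]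
    · refine measureReal_mono (iUnion₂_subset fun x hx => ?_) hVt
      refine (Metric.ball_subset_closedBall).trans ((Metric.closedBall_subset_closedBall ?_).trans
        (Metric.closedBall_subset_cthickening (huK (hsu (by simpa using hx))) 1))
      linarith [ha.2]
    · intro x hx y hy hxy
      exact (hdisj (hsu (by simpa using hx)) (hsu (by simpa using hy)) hxy).mono
        Metric.ball_subset_closedBall Metric.ball_subset_closedBall
    · exact fun x _ => Metric.isOpen_ball.measurableSet
  simp_rw [hvol] at hsum
  rw [Finset.sum_const, nsmul_eq_mul, div_pow] at hsum
  have ha0 := ha.1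
  rw [div_div, le_div_iff₀ (by positivity)]
  calc _ = (hsfin.toFinset.card * (a ^ d / 5 ^ d * b)) * 5 ^ d := by field_simp
    _ ≤ V * 5 ^ d := by gcongr

end Covering

/-! ### The oscillation in mean square. -/

section Oscillation

theorem sq_add_mul_log_le {c₁ c₂ Z : ℝ} (hZ : 0 ≤ Z) :
    (2 * (c₁ + c₂ * Real.log (1 + Z))) ^ 2 ≤ (8 * c₁ ^ 2 + 32 * c₂ ^ 2 + 1) * (1 + Z) := by
  have h1 : 0 ≤ Real.log (1 + Z) := Real.log_nonneg (by linarith)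
  have h2 : Real.log (1 + Z) ≤ 2 * √(1 + Z) := by
    have h3 := Real.log_le_sub_one_of_pos (Real.sqrt_pos.2 (show 0 < 1 + Z by linarith))
    rw [Real.log_sqrt (by linarith)] at h3
    linarith
  have h4 : Real.log (1 + Z) ^ 2 ≤ 4 * (1 + Z) := by
    calc Real.log (1 + Z) ^ 2 ≤ (2 * √(1 + Z)) ^ 2 := by gcongr
      _ = 4 * (1 + Z) := by rw [mul_pow, Real.sq_sqrt (by linarith)]; norm_num
  have h5 : c₂ ^ 2 * Real.log (1 + Z) ^ 2 ≤ c₂ ^ 2 * (4 * (1 + Z)) := by gcongr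
  nlinarith [sq_nonneg (c₁ - c₂ * Real.log (1 + Z)), mul_nonneg (sq_nonneg c₁) hZ]

/-- The squared pathwise modulus is at most linear in `Z`, by `sq_add_mul_log_le`, so the bound on
the expectation of the double integral is enough. -/
theorem exists_lintegral_oscillation_sq_le {d : ℕ} {R : ℝ≥0∞} {q : ℝ → ℝ}
    (hq : IsDifferentiableGauge R q) (hqs : ScalingCondition d R q) {C₀ : ℝ} (hC₀ : 0 < C₀) :
    ∃ c₀ k : ℝ, c₀ ∈ gaugeDomain R ∧ 0 < c₀ ∧ c₀ ≤ 1 ∧ 0 < k ∧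
      ∀ {D : ℕ} {Ω : Type u} [MeasurableSpace Ω] (P : Measure Ω) [IsProbabilityMeasure P]
        (M : EuclideanSpace ℝ (Fin d) → Ω → EuclideanSpace ℝ (Fin D)),
        (∀ᵐ ω ∂P, Continuous fun x => M x ω) →
        ∀ r ∈ Ioc 0 c₀, ∀ x, ExpMomentBound M P q C₀ (c₀ / 2 * r) x →
        ∀ i, ∫⁻ ω, (⨆ y ∈ Metric.ball x (c₀ / 2 * r), ‖M y ω i - M x ω i‖ₑ) ^ 2 ∂P ≤
          ENNReal.ofReal ((q r * k) ^ 2) := by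
  obtain ⟨c₀, c₁, c₂, hc, hc0, hc1, hc₁, hc₂, hosc⟩ := exists_abs_sub_average_le (d := d) hq hqs
  set b : ℝ := volume.real (Metric.ball (0 : EuclideanSpace ℝ (Fin d)) 1) with hb
  have hb0 : 0 < b := ENNReal.toReal_pos (Metric.measure_ball_pos _ _ one_pos).ne'
    measure_ball_lt_top.ne
  -- The ratio `C₀ / b ^ 2` bounds the mean of `Z`, the powers of the radius cancelling.
  set k₀ : ℝ := (8 * c₁ ^ 2 + 32 * c₂ ^ 2 + 1) * (1 + C₀ / b ^ 2) with hk₀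
  have hk₀0 : 0 < k₀ := by positivity
  refine ⟨c₀, √k₀, hc, hc0, hc1, Real.sqrt_pos.2 hk₀0, ?_⟩
  intro D Ω _ P _ M hcont r hr x hM i
  have hrd : r ∈ gaugeDomain R := gaugeDomain_mem_of_le hc hr.1.le hr.2
  have hqr : 0 < q r := hq.apply_pos hrd hr.1
  set a : ℝ := c₀ / 2 * r with ha
  have ha0 : 0 < a := mul_pos (half_pos hc0) hr.1
  have hvol : volume (Metric.ball x a) = ENNReal.ofReal (a ^ d * b) := by
    have := volume_ball_smul_radius (0 : EuclideanSpace ℝ (Fin d)) x (a := 1) ha0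
    rw [mul_one] at this
    rw [this, ENNReal.ofReal_mul (by positivity), hb, measureReal_def,
      ENNReal.ofReal_toReal measure_ball_lt_top.ne]
  have hvb : 0 < a ^ d * b := by positivity
  set I : Ω → ℝ≥0∞ := fun ω => ∫⁻ y in Metric.ball x a, (∫⁻ y' in Metric.ball x a,
    ENNReal.ofReal (Real.exp (‖M y ω - M y' ω‖ / q ‖y - y'‖)) ∂volume) ∂volume with hI
  set w : ℝ≥0∞ := (ENNReal.ofReal ((a ^ d * b) ^ 2)) with hw
  have hw0 : w ≠ 0 := by rw [hw, Ne, ENNReal.ofReal_eq_zero, not_le]; positivity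
  have hwt : w ≠ ∞ := ENNReal.ofReal_ne_top
  set k₁ : ℝ := q r ^ 2 * (8 * c₁ ^ 2 + 32 * c₂ ^ 2 + 1) with hk₁
  have hk₁0 : 0 < k₁ := by positivity
  have hpt : ∀ ω, Continuous (fun y => M y ω) →
      (⨆ y ∈ Metric.ball x a, ‖M y ω i - M x ω i‖ₑ) ^ 2 ≤ ENNReal.ofReal k₁ * (1 + w⁻¹ * I ω) := by
    intro ω hω
    rcases eq_or_ne (I ω) ∞ with htop | htop
    · rw [htop, ENNReal.mul_top (ENNReal.inv_ne_zero.2 hwt), add_top, ENNReal.mul_top (by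
        simpa using hk₁0)]
      exact le_top
    · set Z : ℝ := (w⁻¹ * I ω).toReal with hZ
      have hZ0 : 0 ≤ Z := ENNReal.toReal_nonneg
      have hZe : ENNReal.ofReal Z = w⁻¹ * I ω :=
        ENNReal.ofReal_toReal (ENNReal.mul_ne_top (ENNReal.inv_ne_top.2 hw0) htop)
      have hfi : Continuous fun y => M y ω i := (EuclideanSpace.proj (𝕜 := ℝ) i).continuous.comp hω
      have key := hosc r hr x (fun y => M y ω i) (fun u v => ‖M u ω - M v ω‖) Z hfi (fun u v => by
        simpa using PiLp.norm_apply_le (M u ω - M v ω) i) hZ0 (by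
        have : I ω = ENNReal.ofReal Z * volume (Metric.ball x a) ^ 2 := by
          rw [hZe, hvol, ← ENNReal.ofReal_pow hvb.le, ← hw, mul_right_comm,
            ENNReal.inv_mul_cancel hw0 hwt, one_mul]
        exact this.le)
      set avg := ⨍ u in Metric.ball x a, M u ω i
      have hsup : (⨆ y ∈ Metric.ball x a, ‖M y ω i - M x ω i‖ₑ) ≤
          ENNReal.ofReal (q r * (2 * (c₁ + c₂ * Real.log (1 + Z)))) := by
        refine iSup₂_le fun y hy => ?_
        rw [Real.enorm_eq_ofReal_abs]
        apply ENNReal.ofReal_le_ofReal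
        have h1 := key y hy
        have h2 := key x (Metric.mem_ball_self ha0)
        have h3 := abs_sub_le (M y ω i) avg (M x ω i)
        rw [abs_sub_comm avg] at h3
        linarith
      have hlog : 0 ≤ Real.log (1 + Z) := Real.log_nonneg (by linarith)
      calc _ ≤ ENNReal.ofReal (q r * (2 * (c₁ + c₂ * Real.log (1 + Z)))) ^ 2 := by gcongr
        _ = ENNReal.ofReal (q r ^ 2 * (2 * (c₁ + c₂ * Real.log (1 + Z))) ^ 2) := by
            rw [← ENNReal.ofReal_pow (by positivity), mul_pow]
        _ ≤ ENNReal.ofReal (k₁ * (1 + Z)) := by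
            apply ENNReal.ofReal_le_ofReal
            rw [hk₁, mul_assoc]
            have := sq_add_mul_log_le (c₁ := c₁) (c₂ := c₂) hZ0
            gcongr
        _ = _ := by
            rw [ENNReal.ofReal_mul hk₁0.le, ENNReal.ofReal_add zero_le_one hZ0, hZe,
              ENNReal.ofReal_one]
  calc _ ≤ ∫⁻ ω, ENNReal.ofReal k₁ * (1 + w⁻¹ * I ω) ∂P := by
        refine lintegral_mono_ae ?_
        filter_upwards [hcont] with ω hω using hpt ω hω
    _ = ENNReal.ofReal k₁ * (1 + w⁻¹ * ∫⁻ ω, I ω ∂P) := by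
        rw [lintegral_const_mul' _ _ ENNReal.ofReal_ne_top, lintegral_add_left measurable_const,
          lintegral_const_mul' _ _ (ENNReal.inv_ne_top.2 hw0)]
        simp
    _ ≤ ENNReal.ofReal k₁ * (1 + w⁻¹ * ENNReal.ofReal (C₀ * a ^ (2 * d))) := by
        gcongr
        exact hM
    _ = ENNReal.ofReal ((q r * √k₀) ^ 2) := by
        rw [hw, ← ENNReal.ofReal_inv_of_pos (by positivity), ← ENNReal.ofReal_mul (by positivity),
          ← ENNReal.ofReal_one, ← ENNReal.ofReal_add zero_le_one (by positivity),
          ← ENNReal.ofReal_mul hk₁0.le]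
        congr 1
        rw [mul_pow (q r), Real.sq_sqrt hk₀0.le, hk₁, hk₀]
        field_simp
        ring

end Oscillation

/-! ### Hitting probabilities of balls and of sets. -/

section Hitting

variable {d D : ℕ} {Ω : Type u} [MeasurableSpace Ω] {P : Measure Ω}
  {M : EuclideanSpace ℝ (Fin d) → Ω → EuclideanSpace ℝ (Fin D)}

/-- By continuity a hit occurs at a point of the countable dense set `T`. Letting that point depend
on the coordinate only enlarges the event, and makes it an intersection of independent measurable
ones. -/
theorem measure_exists_mem_isOpen_le_prod (hcont : ∀ᵐ ω ∂P, Continuous fun x => M x ω)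
    (hind : iIndepFun (fun (i : Fin D) (ω : Ω) (x : EuclideanSpace ℝ (Fin d)) => M x ω i) P)
    {B T : Set (EuclideanSpace ℝ (Fin d))} (hB : IsOpen B) (hTc : T.Countable) (hTd : Dense T)
    (z : EuclideanSpace ℝ (Fin D)) (ε : ℝ) :
    P {ω | ∃ y ∈ B, M y ω ∈ Metric.ball z ε} ≤
      ∏ i, P {ω | ∃ y ∈ B ∩ T, |M y ω i - z i| < ε} := by
  have hmeas : ∀ i, MeasurableSet[MeasurableSpace.comap
      (fun (ω : Ω) (x : EuclideanSpace ℝ (Fin d)) => M x ω i) inferInstance]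
      {ω | ∃ y ∈ B ∩ T, |M y ω i - z i| < ε} := by
    intro i
    refine ⟨{p | ∃ y ∈ B ∩ T, |p y - z i| < ε}, ?_, rfl⟩
    have : {p : EuclideanSpace ℝ (Fin d) → ℝ | ∃ y ∈ B ∩ T, |p y - z i| < ε} =
        ⋃ y ∈ B ∩ T, {p | |p y - z i| < ε} := by ext p; simp
    rw [this]
    exact MeasurableSet.biUnion (hTc.mono inter_subset_right) fun y _ =>
      measurableSet_lt (by fun_prop) measurable_const
  rw [← hind.meas_iInter hmeas]
  refine measure_mono_ae ?_
  filter_upwards [hcont] with ω hω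
  rintro ⟨y, hy, hyz⟩
  obtain ⟨t, htT, ht⟩ := hTd.exists_mem_open (hB.inter (Metric.isOpen_ball.preimage hω)) ⟨y, hy, hyz⟩
  refine mem_iInter.2 fun i => ⟨t, ⟨ht.1, htT⟩, ?_⟩
  have h1 : ‖M t ω - z‖ < ε := mem_ball_iff_norm.1 ht.2
  exact (by simpa using PiLp.norm_apply_le (M t ω - z) i : |M t ω i - z i| ≤ _).trans_lt h1

end Hitting

theorem exists_measure_hit_ball_le (d D : ℕ)
    (K : Set (EuclideanSpace ℝ (Fin d))) (hK : IsCompact K)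
    (R : ℝ≥0∞) (q : ℝ → ℝ) (hq : IsDifferentiableGauge R q) (hqs : ScalingCondition d R q)
    (σ C₀ ε₀ : ℝ) (hσ : 0 < σ) (hC₀ : 0 < C₀) (hε₀ : 0 < ε₀) :
    ∃ C ρ : ℝ, 0 < C ∧ 0 < ρ ∧ ∀ (Ω : Type u) [MeasurableSpace Ω] (P : Measure Ω) [IsProbabilityMeasure P]
      (M : EuclideanSpace ℝ (Fin d) → Ω → EuclideanSpace ℝ (Fin D)),
      (∀ x, Measurable (M x)) →
      IsGaussianProcess M P →
      (∀ᵐ ω ∂P, Continuous fun x => M x ω) →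
      iIndepFun (fun (i : Fin D) (ω : Ω) (x : EuclideanSpace ℝ (Fin d)) => M x ω i) P →
      (∀ x ∈ K, ∀ i : Fin D, σ ^ 2 ≤ Var[fun ω => M x ω i; P]) →
      (∀ ε ∈ Ioo 0 ε₀, ∀ x ∈ K, ExpMomentBound M P q C₀ ε x) →
      ∀ τ ∈ Ioc 0 ρ, ∀ z,
        P {ω | ∃ y ∈ K, M y ω ∈ Metric.ball z τ} ≤
          ENNReal.ofReal (C * gaugeRatio d D R q τ) := by
  obtain ⟨c₀, k, hc, hc0, hc1, hk, hosc⟩ := exists_lintegral_oscillation_sq_le.{u} hq hqs hC₀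
  obtain ⟨N, hN, hcover⟩ := exists_finset_cover_card_le hK
  obtain ⟨T, hTc, hTd⟩ := TopologicalSpace.exists_countable_dense (EuclideanSpace ℝ (Fin d))
  have hr₀ : min c₀ ε₀ ∈ gaugeDomain R :=
    gaugeDomain_mem_of_le hc (le_min hc0.le hε₀.le) (min_le_left _ _)
  set H : ℝ := (32 * k + 4) / σ with hH
  have hH0 : 0 < H := by positivity
  -- There are at most `N / (c₀ / 2 * r) ^ d` balls, each contributing `(H * τ) ^ D`; the `1` keeps
  -- the constant positive. The choice of `ρ` ensures `r ≤ c₀` and `r ≤ ε₀`.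
  refine ⟨N * (2 / c₀) ^ d * H ^ D + 1, q (min c₀ ε₀), by positivity,
    hq.apply_pos hr₀ (lt_min hc0 hε₀), ?_⟩
  intro Ω _ P _ M hMm hG hcont hind hvar hexp τ hτ z
  obtain ⟨hr, hqr⟩ := hq.gaugeInv_spec hr₀ ⟨hτ.1.le, hτ.2⟩
  set r := gaugeInv R q τ with hrdef
  have hr0 : 0 < r := by
    rcases hr.1.lt_or_eq with h | h
    · exact h
    · rw [← h, hq.zero] at hqr
      exact absurd hqr hτ.1.ne
  have hrc : r ≤ c₀ := hr.2.trans (min_le_left _ _)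
  have hrε : r ≤ ε₀ := hr.2.trans (min_le_right _ _)
  set a : ℝ := c₀ / 2 * r with ha
  have ha0 : 0 < a := by positivity
  have hahalf : a ≤ r / 2 := by rw [ha]; nlinarith
  have hτ0 := hτ.1
  obtain ⟨F, hFK, hKF, hcard⟩ := hcover a ⟨ha0, by linarith⟩
  have hball : ∀ x ∈ F, P {ω | ∃ y ∈ Metric.ball x a, M y ω ∈ Metric.ball z τ} ≤
      ENNReal.ofReal ((H * τ) ^ D) := by
    intro x hx
    have hxK : x ∈ K := hFK hx
    refine (measure_exists_mem_isOpen_le_prod hcont hind Metric.isOpen_ball hTc hTd z τ).trans ?_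
    have hcomp : ∀ i, P {ω | ∃ y ∈ Metric.ball x a ∩ T, |M y ω i - z i| < τ} ≤
        ENNReal.ofReal (H * τ) := by
      intro i
      have hGi : IsGaussianProcess (fun y ω => M y ω i) P :=
        hG.comp_left fun _ => EuclideanSpace.proj i
      have hmi : ∀ y, Measurable fun ω => M y ω i := fun y =>
        (EuclideanSpace.proj (𝕜 := ℝ) i).continuous.measurable.comp (hMm y)
      have hE := hosc P M hcont r ⟨hr0, hrc⟩ x
        (hexp a ⟨ha0, by linarith⟩ x hxK) i
      rw [hqr] at hE
      refine (measure_exists_abs_sub_lt_le hmi hGi (x := x) (T := Metric.ball x a ∩ T)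
        (hTc.mono inter_subset_right) hσ (hvar x hxK i) (mul_pos hτ0 hk) ?_ (z i) hτ0.le).trans_eq ?_
      · refine le_trans (lintegral_mono fun ω => ?_) hE
        exact pow_le_pow_left' (biSup_mono fun y hy => hy.1) 2
      · congr 1
        rw [hH]; field_simp
    calc _ ≤ ∏ _i : Fin D, ENNReal.ofReal (H * τ) := Finset.prod_le_prod' fun i _ => hcomp i
      _ = _ := by
        rw [Finset.prod_const, Finset.card_univ, Fintype.card_fin, ENNReal.ofReal_pow (by positivity)]
  have hsub : {ω | ∃ y ∈ K, M y ω ∈ Metric.ball z τ} ⊆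
      ⋃ x ∈ F, {ω | ∃ y ∈ Metric.ball x a, M y ω ∈ Metric.ball z τ} := by
    rintro ω ⟨y, hy, hyz⟩
    obtain ⟨x, hx, hyx⟩ := mem_iUnion₂.1 (hKF hy)
    exact mem_iUnion₂.2 ⟨x, hx, y, hyx, hyz⟩
  calc _ ≤ ∑ x ∈ F, P {ω | ∃ y ∈ Metric.ball x a, M y ω ∈ Metric.ball z τ} :=
        (measure_mono hsub).trans (measure_biUnion_finset_le _ _)
    _ ≤ ∑ _x ∈ F, ENNReal.ofReal ((H * τ) ^ D) := Finset.sum_le_sum hball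
    _ = ENNReal.ofReal (F.card * (H * τ) ^ D) := by
        rw [Finset.sum_const, nsmul_eq_mul, ENNReal.ofReal_mul (by positivity), ENNReal.ofReal_natCast]
    _ ≤ _ := by
        apply ENNReal.ofReal_le_ofReal
        rw [gaugeRatio, ← hrdef]
        calc F.card * (H * τ) ^ D ≤ N / a ^ d * (H * τ) ^ D := by gcongr
          _ = N * (2 / c₀) ^ d * H ^ D * (τ ^ D / r ^ d) := by
            rw [ha]; simp only [mul_pow, div_pow]; field_simp
          _ ≤ _ := by gcongr; linarith

theorem theorem2 (d D : ℕ) (hd : 0 < d) (hD : 0 < D)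
    (K : Set (EuclideanSpace ℝ (Fin d))) (hK : IsCompact K) (hKpos : 0 < volume K)
    (R : ℝ≥0∞) (q : ℝ → ℝ) (hq : IsDifferentiableGauge R q) (hqs : ScalingCondition d R q)
    (ρ₀ : ℝ) (hρ₀ : 0 < ρ₀) (hg : StrictMonoOn (gaugeRatio d D R q) (Ioo 0 ρ₀))
    (η σ C₀ ε₀ : ℝ) (hη : 0 < η) (hσ : 0 < σ) (hC₀ : 0 < C₀) (hε₀ : 0 < ε₀) :
    ∃ C : ℝ≥0, ∀ (Ω : Type u) [MeasurableSpace Ω] (P : Measure Ω) [IsProbabilityMeasure P]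
      (M : EuclideanSpace ℝ (Fin d) → Ω → EuclideanSpace ℝ (Fin D)),
      (∀ x, Measurable (M x)) →
      IsGaussianProcess M P →
      (∀ᵐ ω ∂P, Continuous fun x => M x ω) →
      HasIIDComponents M P →
      (∀ x ∈ Metric.thickening η K, ∀ i : Fin D, σ ^ 2 ≤ Var[fun ω => M x ω i; P]) →
      (∀ ε ∈ Ioo 0 ε₀, ∀ x ∈ Metric.thickening η K, ExpMomentBound M P q C₀ ε x) →
      ∀ A : Set (EuclideanSpace ℝ (Fin D)), MeasurableSet A →
        P {ω | (((fun x => M x ω) '' K) ∩ A).Nonempty} ≤ C * gHausdorff (gaugeRatio d D R q) A := by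
  obtain ⟨C, ρ, hC, hρ, hhit⟩ :=
    exists_measure_hit_ball_le.{u} d D K hK R q hq hqs σ C₀ ε₀ hσ hC₀ hε₀
  have hKη : K ⊆ Metric.thickening η K := Metric.self_subset_thickening hη K
  refine ⟨C.toNNReal, fun Ω _ P _ M hMm hG hcont hiid hvar hexp A _ => ?_⟩
  have hball := hhit Ω P M hMm hG hcont hiid.indep (fun x hx => hvar x (hKη hx))
    (fun ε hε x hx => hexp ε hε x (hKη hx))
  have hC0 : (C.toNNReal : ℝ≥0∞) ≠ 0 := by simpa using hC
  refine le_trans ?_ (mul_le_mul_right (le_iSup₂ (f := fun (ε : ℝ) (_ : 0 < ε) =>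
    gHausdorffPre (gaugeRatio d D R q) ε A) (ρ / 2) (half_pos hρ)) _)
  -- With the constant moved to the left, the bound can be checked on each covering separately.
  rw [← ENNReal.div_le_iff' hC0 ENNReal.coe_ne_top]
  refine le_iInf fun s => le_iInf fun x => le_iInf fun r => le_iInf fun hr => le_iInf fun hA => ?_
  rw [ENNReal.div_le_iff' hC0 ENNReal.coe_ne_top]
  -- Doubling the radii matches the argument `2 * r i` of the gauge ratio; coverings with radii at
  -- most `ρ / 2` keep the doubled ones at most `ρ`.
  have hsub : {ω | (((fun x => M x ω) '' K) ∩ A).Nonempty} ⊆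
      ⋃ i : s, {ω | ∃ y ∈ K, M y ω ∈ Metric.ball (x i) (2 * r i)} := by
    rintro ω ⟨_, ⟨y, hy, rfl⟩, hyA⟩
    obtain ⟨i, hi, hyi⟩ := mem_iUnion₂.1 (hA hyA)
    refine mem_iUnion.2 ⟨⟨i, hi⟩, y, hy, Metric.ball_subset_ball ?_ hyi⟩
    have := (hr i hi).1
    simp only
    linarith
  calc _ ≤ ∑' i : s, P {ω | ∃ y ∈ K, M y ω ∈ Metric.ball (x i) (2 * r i)} :=
        (measure_mono hsub).trans (measure_iUnion_le _)
    _ ≤ ∑' i : s, C.toNNReal * ENNReal.ofReal (gaugeRatio d D R q (2 * r i)) := by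
        refine ENNReal.tsum_le_tsum fun i => ?_
        obtain ⟨h1, h2⟩ := hr i i.2
        refine (hball (2 * r i) ⟨by linarith, by linarith⟩ (x i)).trans_eq ?_
        rw [ENNReal.ofReal_mul hC.le]
        rfl
    _ = _ := ENNReal.tsum_mul_left
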